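/- Let $I=(0,\infty)$, $dm=2x^2\,dx$ on $I$, and let $\mathcal E$ be the three-dimensional Bessel Dirichlet form in $L^2(I,m)$: $$\mathcal D=\Big\{u\in L^2(I,m):\ u \text{ locally absolutely continuous on } I,\ \int_0^\infty u'(x)^2x^2\,dx<\infty\Big\},\qquad \mathcal E[u]=\int_0^\infty u'(x)^2x^2\,dx .$$ Put $\mathcal E_\lambda(u,v)=\mathcal E(u,v)+\lambda\int_I uv\,dm$ for $\lambda>0$. Let $\mathbb N=\{1,2,\dots\}$, let $a_k>0$ for all $k\in\mathbb N$, and let $$\mu=\mu_{ac}+\mu_{disc},\qquad \mu_{ac}=x^2\mathbf 1_{(0,1)}\,dx,\qquad \mu_{disc}=\sum_{k=1}^\infty a_k\delta_k,$$ with support $F=[0,1]\cup\mathbb N$. Let $J:\mathcal D\cap L^2(F,\mu)\to L^2(F,\mu)$, $Ju=u|_F$, where $\ker J=\{u\in\mathcal D: u=0\ \mu\text{-a.e.}\}$, and let $P_\lambda$ be the orthogonal projection in $(\mathcal D,\mathcal E_\lambda)$ onto the $\mathcal E_\lambda$-orthogonal complement of $\ker J$. Let $\check{\mathcal E}_\lambda$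 be the form in $L^2(F,\mu)$ with domain $\operatorname{ran}J$ and $\check{\mathcal E}_\lambda[Ju]=\mathcal E_\lambda[P_\lambda u]$. The trace $\check{\mathcal E}$ of $\mathcal E$ with respect to $\mu$ is the Mosco limit of $\check{\mathcal E}_\lambda$ in $L^2(F,\mu)$ as $\lambda\downarrow0$. Further let $$\check{\mathcal D}_{\max}=\Big\{\psi\in L^2(F,\mu):\ \psi \text{ locally absolutely continuous on }(0,1],\ \check{\mathcal E}^{(c)}[\psi]+\check{\mathcal E}^{(J)}[\psi]<\infty\Big\},$$ $$\check{\mathcal E}^{(c)}[\psi]=\int_0^1\psi'(x)^2x^2\,dx,\qquad \check{\mathcal E}^{(J)}[\psi]=\sum_{k=1}^\infty k(k+1)\big(\psi(k+1)-\psi(k)\big)^2,$$ where elements of $L^2(F,\mu)$ are identified with a version that is locally absolutely continuous on $(0,1]$ if there is one, and let $\mathcal Q=\check{\mathcal E}^{(c)}+\check{\mathcal E}^{(J)}$ with domain $\check{\mathcal D}_{\max}$. Then the trace form $\check{\mathcal E}$ exists and is uniquely determined, $\operatorname{ran}J\subseteq\check{\mathcal D}_{\max}$, and: 1. $\mathcal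 Q|_{\operatorname{ran}J}$ is closable in $L^2(F,\mu)$ and $\check{\mathcal E}=\overline{\mathcal Q|_{\operatorname{ran}J}}$. 2. If $\mu_{disc}(\mathbb N)=\infty$, then $\check{\mathcal E}=\mathcal Q$, including equality of the domains. Moreover $\mathcal Q$ is on $\check{\mathcal D}_{\max}$ the sum of $\check{\mathcal E}^{(c)}$, which is strongly local (its bilinear form vanishes at $(u,v)$ whenever $u,v\in\check{\mathcal D}_{\max}$ and $v$ is $\mu$-a.e. equal to a constant on a neighbourhood of the support of $u$), and of $\check{\mathcal E}^{(J)}$, which is of pure jump type (it equals $\iint(\psi(x)-\psi(y))^2\,j(dx,dy)$ for some symmetric, locally finite measure $j$ that does not charge the diagonal and whose marginal is absolutely continuous with respect to $\mu$). -/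

import Mathlib

open MeasureTheory Filter Topology Set
open scoped ENNReal

noncomputable section

namespace BesselTrace

/-! ### Nonnegative quadratic forms on a real Hilbert space

A quadratic form `q` with domain `D` is encoded by the function equal to `q` on `D` and to `⊤`
outside `D`, so that the domain of `q` is `{f | q f < ⊤}`. -/

section Forms

variable {H : Type*} [NormedAddCommGroup H] [InnerProductSpace ℝ H]

/-- The form `q` restricted to the set `S`. -/
def restrictForm (q : H → ℝ≥0∞) (S : Set H) (f : H) : ℝ≥0∞ :=
  ⨅ _ : f ∈ S, q f

/-- `u` is a `q`-Cauchy sequence in the domain of `q` which converges to `f` in `H`. -/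
structure IsApproximating (q : H → ℝ≥0∞) (u : ℕ → H) (f : H) : Prop where
  mem_dom : ∀ n, q (u n) < ⊤
  tendsto : Tendsto u atTop (𝓝 f)
  cauchy : Tendsto (fun p : ℕ × ℕ => q (u p.1 - u p.2)) atTop (𝓝 0)

/-- `q` is closable and `t` is its closure: the domain of `t` consists of the limits of the
approximating sequences, and along every such sequence `q` converges to the value of `t`
at the limit. -/
def IsFormClosure (q t : H → ℝ≥0∞) : Prop :=
  (∀ f, t f < ⊤ ↔ ∃ u : ℕ → H, IsApproximating q u f) ∧
  ∀ (f : H) (u : ℕ → H), IsApproximating q u f → Tendsto (fun n => q (u n)) atTop (𝓝 (t f))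

/-- Weak convergence of a sequence in `H`. -/
def WeaklyTendsto (u : ℕ → H) (f : H) : Prop :=
  ∀ g : H, Tendsto (fun n => inner ℝ g (u n)) atTop (𝓝 (inner ℝ g f))

/-- Mosco convergence of a sequence of forms. -/
def MoscoTendsto (q : ℕ → H → ℝ≥0∞) (t : H → ℝ≥0∞) : Prop :=
  (∀ (u : ℕ → H) (f : H), WeaklyTendsto u f → t f ≤ liminf (fun n => q n (u n)) atTop) ∧
  ∀ f : H, ∃ u : ℕ → H, Tendsto u atTop (𝓝 f) ∧ limsup (fun n => q n (u n)) atTop ≤ t f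

/-- `t` is the Mosco limit of `q l` as `l ↓ 0`. -/
def IsMoscoLimitAtZero (q : ℝ → H → ℝ≥0∞) (t : H → ℝ≥0∞) : Prop :=
  ∀ l : ℕ → ℝ, (∀ n, 0 < l n) → Tendsto l atTop (𝓝 0) → MoscoTendsto (fun n => q (l n)) t

end Forms

/-! ### The three-dimensional Bessel form `𝓔` on `I = (0, ∞)` -/

/-- The measure `2 x² dx` on `(0, ∞)`. -/
def m : Measure ℝ :=
  (volume.restrict (Ioi 0)).withDensity fun x => ENNReal.ofReal (2 * x ^ 2)

/-- The domain `𝓓` of `𝓔`: functions absolutely continuous on the compact subintervals of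
`(0, ∞)`, lying in `L²(m)`, with `∫₀^∞ u'(x)² x² dx < ∞`. Only the values on `(0, ∞)` matter. -/
structure InDom (u : ℝ → ℝ) : Prop where
  ac : ∀ b c : ℝ, 0 < b → b ≤ c → AbsolutelyContinuousOnInterval u b c
  energy : ∫⁻ x in Ioi (0 : ℝ), ENNReal.ofReal (deriv u x ^ 2 * x ^ 2) < ⊤
  memLp : MemLp u 2 m

/-- `𝓔_l(u, v) = ∫₀^∞ u' v' x² dx + l ∫ u v dm`. -/
def besselForm (l : ℝ) (u v : ℝ → ℝ) : ℝ :=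
  (∫ x in Ioi (0 : ℝ), deriv u x * deriv v x * x ^ 2) + l * ∫ x, u x * v x ∂m

/-! ### The measure `μ` -/

/-- `x² 1_{(0,1)} dx`. -/
def muAC : Measure ℝ :=
  (volume.restrict (Ioo 0 1)).withDensity fun x => ENNReal.ofReal (x ^ 2)

/-- `∑_{k ≥ 1} a_k δ_k`. -/
def muDisc (a : ℕ+ → ℝ) : Measure ℝ :=
  Measure.sum fun k : ℕ+ => ENNReal.ofReal (a k) • Measure.dirac (k : ℝ)

/-- The mixed measure `μ`; it is carried by `(0,1) ∪ ℕ`. -/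
def mu (a : ℕ+ → ℝ) : Measure ℝ := muAC + muDisc a

/-- `L²(F, μ)`, where `F = [0,1] ∪ ℕ` is the support of `μ`. -/
abbrev L2 (a : ℕ+ → ℝ) := Lp ℝ 2 (mu a)

/-! ### The trace of `𝓔` with respect to `μ` -/

/-- `u ∈ D(J)` and `Ju = f`, where `J` is the restriction operator from `𝓓 ∩ L²(F, μ)` to
`L²(F, μ)`. -/
def IsRestriction (a : ℕ+ → ℝ) (u : ℝ → ℝ) (f : L2 a) : Prop :=
  InDom u ∧ f =ᵐ[mu a] u

/-- The range of `J`. -/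
def ranJ (a : ℕ+ → ℝ) : Set (L2 a) := {f | ∃ u, IsRestriction a u f}

/-- The kernel of `J`. -/
def kerJ (a : ℕ+ → ℝ) : Set (ℝ → ℝ) := {u | InDom u ∧ u =ᵐ[mu a] 0}

/-- The orthogonal complement of `ker J` in `(𝓓, 𝓔_l)`. -/
def kerJPerp (a : ℕ+ → ℝ) (l : ℝ) : Set (ℝ → ℝ) :=
  {w | InDom w ∧ ∀ v ∈ kerJ a, besselForm l w v = 0}

/-- `w = P_l u`: `w` is the `𝓔_l`-orthogonal projection of `u` onto the orthogonal complement
of `ker J`. -/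
def IsProjection (a : ℕ+ → ℝ) (l : ℝ) (u w : ℝ → ℝ) : Prop :=
  w ∈ kerJPerp a l ∧ ∀ v ∈ kerJPerp a l, besselForm l (u - w) v = 0

/-- The form with domain `ran J` given by `Ju ↦ 𝓔_l[P_l u]`. (For `l > 0` the infimum runs over
a single value if `f ∈ ran J`, since `P_l u` depends on `Ju` only, and it is `⊤` otherwise.) -/
def traceApprox (a : ℕ+ → ℝ) (l : ℝ) (f : L2 a) : ℝ≥0∞ :=
  ⨅ (u : ℝ → ℝ) (w : ℝ → ℝ) (_ : IsRestriction a u f) (_ : IsProjection a l u w),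
    ENNReal.ofReal (besselForm l w w)

/-- `t` is the trace of `𝓔` with respect to `μ`: the Mosco limit of the forms
`Ju ↦ 𝓔_l[P_l u]` as `l ↓ 0`. -/
def IsTraceForm (a : ℕ+ → ℝ) (t : L2 a → ℝ≥0∞) : Prop :=
  IsMoscoLimitAtZero (traceApprox a) t

/-! ### The form `𝓠` -/

/-- `∫₀¹ ψ'(x)² x² dx`. -/
def contEnergy (ψ : ℝ → ℝ) : ℝ≥0∞ :=
  ∫⁻ x in Ioo (0 : ℝ) 1, ENNReal.ofReal (deriv ψ x ^ 2 * x ^ 2)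

/-- `∑_{k ≥ 1} k (k + 1) (ψ(k + 1) - ψ(k))²`. -/
def jumpEnergy (ψ : ℝ → ℝ) : ℝ≥0∞ :=
  ∑' k : ℕ+, ENNReal.ofReal ((k : ℝ) * ((k : ℝ) + 1) * (ψ ((k : ℝ) + 1) - ψ (k : ℝ)) ^ 2)

/-- `ψ` is a version of `f ∈ L²(F, μ)` which is locally absolutely continuous on `(0, 1]`. -/
def IsACVersion (a : ℕ+ → ℝ) (f : L2 a) (ψ : ℝ → ℝ) : Prop :=
  f =ᵐ[mu a] ψ ∧ ∀ b : ℝ, 0 < b → b ≤ 1 → AbsolutelyContinuousOnInterval ψ b 1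

/-- The maximal domain: the `f ∈ L²(F, μ)` which have a version locally absolutely continuous on
`(0, 1]` with `∫₀¹ ψ'(x)² x² dx + ∑ k (k + 1) (ψ(k + 1) - ψ(k))² < ∞`. -/
def maxDom (a : ℕ+ → ℝ) : Set (L2 a) :=
  {f | ∃ ψ, IsACVersion a f ψ ∧ contEnergy ψ + jumpEnergy ψ < ⊤}

/-- `∫₀¹ ψ'(x)² x² dx` for any such version `ψ` of `f`; the value does not depend on `ψ`,
see `contForm_eq`. -/
def contForm (a : ℕ+ → ℝ) (f : L2 a) : ℝ≥0∞ :=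
  ⨅ (ψ : ℝ → ℝ) (_ : IsACVersion a f ψ), contEnergy ψ

/-- `∑ k (k + 1) (ψ(k + 1) - ψ(k))²` for any such version `ψ` of `f`; the value does not depend
on `ψ`, see `jumpForm_eq`. -/
def jumpForm (a : ℕ+ → ℝ) (f : L2 a) : ℝ≥0∞ :=
  ⨅ (ψ : ℝ → ℝ) (_ : IsACVersion a f ψ), jumpEnergy ψ

/-- The form `𝓠`, with domain `maxDom`. -/
def Q (a : ℕ+ → ℝ) : L2 a → ℝ≥0∞ :=
  restrictForm (fun f => contForm a f + jumpForm a f) (maxDom a)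

theorem eq_natCast_of_ae {a : ℕ+ → ℝ} (ha : ∀ k, 0 < a k) {ψ φ : ℝ → ℝ}
    (h : ψ =ᵐ[mu a] φ) (k : ℕ+) : ψ (k : ℝ) = φ (k : ℝ) := by
  have h1 : ψ =ᵐ[muDisc a] φ := h.filter_mono (ae_mono (Measure.le_add_left le_rfl))
  have h2 := (Measure.ae_sum_iff.1 h1) k
  rw [Measure.ae_ennreal_smul_measure_iff (by simpa using ha k)] at h2
  exact (ae_dirac_eq (a := (k : ℝ)) ▸ h2 : ∀ᶠ x in pure (k : ℝ), ψ x = φ x)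

theorem eqOn_of_ae {a : ℕ+ → ℝ} {ψ φ : ℝ → ℝ} (h : ψ =ᵐ[mu a] φ)
    (hψ : ∀ b : ℝ, 0 < b → b ≤ 1 → AbsolutelyContinuousOnInterval ψ b 1)
    (hφ : ∀ b : ℝ, 0 < b → b ≤ 1 → AbsolutelyContinuousOnInterval φ b 1) :
    EqOn ψ φ (Ioo 0 1) := by
  have h1 : ψ =ᵐ[muAC] φ := h.filter_mono (ae_mono (Measure.le_add_right le_rfl))
  have h2 : ψ =ᵐ[volume.restrict (Ioo 0 1)] φ := by
    have h3 := (ae_withDensity_iff (by fun_prop)).1 h1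
    filter_upwards [h3, ae_restrict_mem measurableSet_Ioo] with x hx hx0
    exact hx (by simpa using (pow_pos hx0.1 2).ne')
  have hc : ∀ χ : ℝ → ℝ, (∀ b : ℝ, 0 < b → b ≤ 1 → AbsolutelyContinuousOnInterval χ b 1) →
      ContinuousOn χ (Ioo 0 1) := by
    intro χ hχ x hx
    have h4 := (hχ (x / 2) (by linarith [hx.1]) (by linarith [hx.1, hx.2])).continuousOn
    rw [uIcc_of_le (by linarith [hx.1, hx.2])] at h4
    exact (h4.continuousAt (Icc_mem_nhds (by linarith [hx.1]) hx.2)).continuousWithinAt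
  exact Measure.eqOn_open_of_ae_eq h2 isOpen_Ioo (hc ψ hψ) (hc φ hφ)

theorem contForm_eq {a : ℕ+ → ℝ} {f : L2 a} {ψ : ℝ → ℝ} (h : IsACVersion a f ψ) :
    contForm a f = contEnergy ψ := by
  refine le_antisymm (iInf₂_le ψ h) (le_iInf₂ fun φ hφ => le_of_eq ?_)
  have he := eqOn_of_ae (h.1.symm.trans hφ.1) h.2 hφ.2
  refine setLIntegral_congr_fun measurableSet_Ioo fun x hx => ?_
  have hd : deriv ψ x = deriv φ x :=
    (he.eventuallyEq_of_mem (isOpen_Ioo.mem_nhds hx)).deriv_eq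
  simp only [hd]

theorem jumpForm_eq {a : ℕ+ → ℝ} (ha : ∀ k, 0 < a k) {f : L2 a} {ψ : ℝ → ℝ}
    (h : IsACVersion a f ψ) : jumpForm a f = jumpEnergy ψ := by
  refine le_antisymm (iInf₂_le ψ h) (le_iInf₂ fun φ hφ => le_of_eq ?_)
  have he := fun k => eq_natCast_of_ae ha (h.1.symm.trans hφ.1) k
  refine tsum_congr fun k => ?_
  have h1 := he (k + 1)
  push_cast at h1
  rw [he k, h1]

/-! ### Strongly local forms and jump forms -/

/-- The quadratic form `q` is strongly local on `D`: its bilinear form vanishes at `(u, v)`,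
that is, `q[u + v] = q[u] + q[v]`, whenever `v` is constant on a neighbourhood of the support
of `u`. -/
def StronglyLocalOn (ν : Measure ℝ) (D : Set (Lp ℝ 2 ν)) (q : Lp ℝ 2 ν → ℝ≥0∞) : Prop :=
  ∀ u ∈ D, ∀ v ∈ D, ∀ (V : Set ℝ) (c : ℝ), IsOpen V →
    (ν.withDensity fun x => ‖u x‖ₑ).support ⊆ V → (∀ᵐ x ∂ν, x ∈ V → v x = c) →
    q (u + v) = q u + q v

/-- The quadratic form `q` is of pure jump type on `D`: it is given by a symmetric jump measure
off the diagonal. The condition `map fst ≪ ν` makes the integral independent of the version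
of `f`. -/
def PureJumpOn (ν : Measure ℝ) (D : Set (Lp ℝ 2 ν)) (q : Lp ℝ 2 ν → ℝ≥0∞) : Prop :=
  ∃ j : Measure (ℝ × ℝ), IsLocallyFiniteMeasure j ∧ j.map Prod.swap = j ∧
    j {p | p.1 = p.2} = 0 ∧ (j.map Prod.fst) ≪ ν ∧
    ∀ f ∈ D, q f = ∫⁻ p, ENNReal.ofReal ((f p.1 - f p.2) ^ 2) ∂j

end BesselTrace

end

/-! The form `𝓠` is the squared norm of a gradient. The derivative on `(0, 1)` and the increments on
`ℕ` together form one element of `L²(mu jc)`, where `jc k = k (k + 1)`. Closedness and closability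
of `𝓠` thus become closedness of the graph `gradGraph` in a product of Hilbert spaces
(`isClosed_gradGraph`), and the closure of `𝓠` on `ran J` is the form of the closed graph of
`ranJGraph`.

The approximating forms are squeezed towards `𝓠` on `ran J`. From below: among functions on `(k, k +
1)` with prescribed boundary values, the least energy `∫ u'² x² dx` belongs to the harmonic function
`A + B / x` and equals `k (k + 1)` times the squared increment, so every extension of `f` has energy
at least `𝓠[f]` (`LocAC.contEnergy_add_jumpEnergy_le`). From above: making a given `u ∈ 𝓓` harmonic
on `(1, 2), …, (n, n + 1)` leaves only the tail energy of `u` as excess, and for this fixed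
competitor the term with factor `l` vanishes as `l ↓ 0` (`InDom.exists_interpolation`,
`eventually_traceApprox_le`). Forms squeezed in this way have the closure as Mosco limit: closed
graphs are weakly closed, which gives the liminf inequality, and a diagonal sequence gives recovery
(`isMoscoLimitAtZero_graphForm`).

If the discrete mass is infinite, `ran J` is a core of `𝓠`. Finite jump energy makes `ψ(k)`
converge, because `∑ 1 / (k (k + 1)) < ∞`, and square integrability forces the limit to be zero
(`tendsto_zero_of_not_summable`). Subtracting truncations of `ψ` at small heights then produces
approximants that vanish at all large integers (`mem_closure_ranJGraph`), and those lie in `ran J`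
by piecewise linear interpolation (`mem_ranJ_of_eventually_zero`). -/

/-! ### Forms given by the graph of an operator between Hilbert spaces -/

namespace BesselTrace

section Abstract

variable {H Y : Type*} [NormedAddCommGroup H] [InnerProductSpace ℝ H]
  [NormedAddCommGroup Y] [InnerProductSpace ℝ Y]

/-- The quadratic form `f ↦ ‖y‖²`, `(f, y) ∈ G`. -/
noncomputable def graphForm (G : Submodule ℝ (H × Y)) (f : H) : ℝ≥0∞ :=
  ⨅ (y : Y) (_ : (f, y) ∈ G), ‖y‖ₑ ^ 2

/-- The graph `G` is single valued. -/
def SingleValued (G : Submodule ℝ (H × Y)) : Prop := ∀ y : Y, ((0 : H), y) ∈ G → y = 0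

theorem SingleValued.mono {G G' : Submodule ℝ (H × Y)} (h : SingleValued G) (hG : G' ≤ G) :
    SingleValued G' := fun y hy => h y (hG hy)

theorem graphForm_eq {G : Submodule ℝ (H × Y)} (hG : SingleValued G) {f : H} {y : Y}
    (h : (f, y) ∈ G) : graphForm G f = ‖y‖ₑ ^ 2 := by
  refine le_antisymm (iInf₂_le y h) (le_iInf₂ fun z hz => ?_)
  have := hG (y - z) (by simpa using G.sub_mem h hz)
  rw [sub_eq_zero.1 this]

theorem graphForm_le {G : Submodule ℝ (H × Y)} {f : H} {y : Y}
    (h : (f, y) ∈ G) : graphForm G f ≤ ‖y‖ₑ ^ 2 := iInf₂_le y h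

theorem graphForm_lt_top_iff {G : Submodule ℝ (H × Y)} {f : H} :
    graphForm G f < ⊤ ↔ ∃ y, (f, y) ∈ G := by
  constructor
  · intro h
    by_contra! hc
    simp [graphForm, hc] at h
  · rintro ⟨y, hy⟩
    exact (graphForm_le hy).trans_lt (by simp)

/-- Cauchy sequences for the form are sequences whose second graph components are Cauchy in `Y`.
Completeness provides a limit component, and single-valuedness of the closure makes its norm depend
on `f` alone. -/
theorem isFormClosure_graphForm [CompleteSpace Y] {G : Submodule ℝ (H × Y)}
    (hG : SingleValued G.topologicalClosure) :
    IsFormClosure (graphForm G) (graphForm G.topologicalClosure) := by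
  have key : ∀ (f : H) (u : ℕ → H), IsApproximating (graphForm G) u f →
      ∃ y, (f, y) ∈ G.topologicalClosure ∧ Tendsto (fun n => graphForm G (u n)) atTop
        (𝓝 (‖y‖ₑ ^ 2)) := by
    intro f u hu
    have hG0 := hG.mono G.le_topologicalClosure
    choose y hy using fun n => graphForm_lt_top_iff.1 (hu.mem_dom n)
    have hc : CauchySeq y := by
      rw [cauchySeq_iff_tendsto_dist_atTop_0, prod_atTop_atTop_eq.symm]
      have h1 : Tendsto (fun p : ℕ × ℕ => ‖y p.1 - y p.2‖ₑ ^ 2) (atTop ×ˢ atTop) (𝓝 0) := by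
        rw [prod_atTop_atTop_eq]
        refine hu.cauchy.congr fun p => graphForm_eq hG0 ?_
        simpa using G.sub_mem (hy p.1) (hy p.2)
      -- A square root in `ℝ≥0∞` passes from squared norms to norms.
      have h2 := (ENNReal.continuous_rpow_const (y := 2⁻¹)).tendsto 0 |>.comp h1
      have h3 : Tendsto (fun p : ℕ × ℕ => ‖y p.1 - y p.2‖ₑ) (atTop ×ˢ atTop) (𝓝 0) := by
        refine (h2.congr fun p => ?_).trans (by simp)
        rw [Function.comp_apply, ← ENNReal.rpow_natCast, ← ENNReal.rpow_mul]
        simp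
      have h4 := (ENNReal.tendsto_toReal ENNReal.zero_ne_top).comp h3
      refine h4.congr fun p => ?_
      simp [dist_eq_norm]
    obtain ⟨z, hz⟩ := cauchySeq_tendsto_of_complete hc
    refine ⟨z, mem_closure_of_tendsto (hu.tendsto.prodMk_nhds hz) (Eventually.of_forall hy), ?_⟩
    refine Tendsto.congr (fun n => (graphForm_eq hG0 (hy n)).symm) ?_
    exact (ENNReal.continuous_pow 2).tendsto _ |>.comp hz.enorm
  refine ⟨fun f => ⟨fun h => ?_, ?_⟩, fun f u hu => ?_⟩
  · obtain ⟨y, hy⟩ := graphForm_lt_top_iff.1 h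
    obtain ⟨p, hp, hpl⟩ := mem_closure_iff_seq_limit.1 hy
    refine ⟨fun n => (p n).1, fun n => graphForm_lt_top_iff.2 ⟨_, hp n⟩,
      (continuous_fst.tendsto _).comp hpl, ?_⟩
    have h2 : Tendsto (fun n => (p n).2) atTop (𝓝 y) := (continuous_snd.tendsto _).comp hpl
    have h3 : Tendsto (fun q : ℕ × ℕ => ‖(p q.1).2 - (p q.2).2‖ₑ ^ 2) atTop (𝓝 0) := by
      rw [← prod_atTop_atTop_eq]
      have h5 : Tendsto (fun q : ℕ × ℕ => (p q.1).2) (atTop ×ˢ atTop) (𝓝 y) := h2.comp tendsto_fst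
      have h6 : Tendsto (fun q : ℕ × ℕ => (p q.2).2) (atTop ×ˢ atTop) (𝓝 y) := h2.comp tendsto_snd
      have := h5.sub h6
      have h4 := (ENNReal.continuous_pow 2).tendsto _ |>.comp this.enorm
      simpa [Function.comp_def] using h4
    refine tendsto_of_tendsto_of_tendsto_of_le_of_le tendsto_const_nhds h3 (fun _ => zero_le)
      fun q => graphForm_le ?_
    exact G.sub_mem (hp q.1) (hp q.2)
  · rintro ⟨u, hu⟩
    obtain ⟨y, hy, -⟩ := key f u hu
    exact graphForm_lt_top_iff.2 ⟨y, hy⟩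
  · obtain ⟨y, hy, hl⟩ := key f u hu
    rwa [graphForm_eq hG hy]

/-! ### Mosco convergence of graph forms -/

theorem WeaklyTendsto.of_tendsto {u : ℕ → H} {f : H} (h : Tendsto u atTop (𝓝 f)) :
    WeaklyTendsto u f := fun _ => tendsto_const_nhds.inner h

/-- A recovery sequence for `t` converges strongly, hence weakly, so it can be tested in the liminf
inequality for `s`. -/
theorem MoscoTendsto.le {q : ℕ → H → ℝ≥0∞} {s t : H → ℝ≥0∞} (hs : MoscoTendsto q s)
    (ht : MoscoTendsto q t) : s ≤ t := by
  intro f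
  obtain ⟨u, hu, hl⟩ := ht.2 f
  exact (hs.1 u f (.of_tendsto hu)).trans ((liminf_le_limsup).trans hl)

theorem IsMoscoLimitAtZero.unique {q : ℝ → H → ℝ≥0∞} {s t : H → ℝ≥0∞}
    (hs : IsMoscoLimitAtZero q s) (ht : IsMoscoLimitAtZero q t) : s = t := by
  have h0 : ∀ n : ℕ, (0 : ℝ) < 1 / ((n : ℝ) + 1) := fun n => Nat.one_div_pos_of_nat
  have h1 := hs _ h0 tendsto_one_div_add_atTop_nhds_zero_nat
  have h2 := ht _ h0 tendsto_one_div_add_atTop_nhds_zero_nat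
  exact le_antisymm (h1.le h2) (h2.le h1)

/-- If `(u n, y n) ∈ G` with `G` closed, `u` tends weakly to `f`, and `y` is bounded along a
subsequence, then `f` is in the domain of `G`, with the same bound. -/
theorem exists_mem_of_weaklyTendsto [CompleteSpace Y] {G : Submodule ℝ (H × Y)}
    (hG : IsClosed (G : Set (H × Y))) {u : ℕ → H} {f : H} (hu : WeaklyTendsto u f)
    [CompleteSpace H] {y : ℕ → Y} {C : ℝ} (h : ∃ᶠ n in atTop, (u n, y n) ∈ G ∧ ‖y n‖ ≤ C) :
    ∃ z, (f, z) ∈ G ∧ ‖z‖ ≤ C := by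
  have : NeBot (atTop ⊓ 𝓟 {n | (u n, y n) ∈ G ∧ ‖y n‖ ≤ C}) :=
    frequently_mem_iff_neBot.1 h
  -- An ultrafilter on the good indices replaces a weakly convergent subsequence: Banach–Alaoglu
  -- gives a weak limit of `y` along it.
  set U : Ultrafilter ℕ := Ultrafilter.of (atTop ⊓ 𝓟 {n | (u n, y n) ∈ G ∧ ‖y n‖ ≤ C})
  have hU : (U : Filter ℕ) ≤ atTop ⊓ 𝓟 {n | (u n, y n) ∈ G ∧ ‖y n‖ ≤ C} := Ultrafilter.of_le _
  have hev : ∀ᶠ n in (U : Filter ℕ), (u n, y n) ∈ G ∧ ‖y n‖ ≤ C :=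
    hU.trans inf_le_right (mem_principal_self _)
  let e : ℕ → WeakDual ℝ Y := fun n =>
    (WeakDual.toStrongDual (𝕜 := ℝ) (E := Y)).symm (InnerProductSpace.toDual ℝ Y (y n))
  have hmem : (WeakDual.toStrongDual (𝕜 := ℝ) (E := Y)) ⁻¹'
      Metric.closedBall 0 C ∈ U.map e := by
    change ∀ᶠ n in (U : Filter ℕ), _
    filter_upwards [hev] with n hn
    simpa [e] using hn.2
  obtain ⟨φ, hφ, hlim⟩ := (WeakDual.isCompact_closedBall (𝕜 := ℝ) (E := Y) 0 C).ultrafilter_le_nhds'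
    _ hmem
  set z : Y := (InnerProductSpace.toDual ℝ Y).symm (WeakDual.toStrongDual φ)
  have hz : ∀ w : Y, Tendsto (fun n => inner ℝ w (y n)) U (𝓝 (inner ℝ w z)) := by
    intro w
    have h1 : Tendsto e U (𝓝 φ) := hlim
    have h2 := ((WeakDual.eval_continuous w).tendsto φ).comp h1
    rw [real_inner_comm, InnerProductSpace.toDual_symm_apply]
    refine h2.congr fun n => ?_
    rw [real_inner_comm]
    rfl
  refine ⟨z, ?_, ?_⟩
  -- A closed subspace is weakly closed: a functional separating the weak limit from `G` splits into
  -- two inner products, each of which passes to the limit along `U`.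
  · by_contra hc
    obtain ⟨ℓ, r, hl, hr⟩ := geometric_hahn_banach_closed_point G.convex hG hc
    let p := (InnerProductSpace.toDual ℝ H).symm (ℓ.comp (ContinuousLinearMap.inl ℝ H Y))
    let q := (InnerProductSpace.toDual ℝ Y).symm (ℓ.comp (ContinuousLinearMap.inr ℝ H Y))
    have hpq : ∀ (a : H) (b : Y), ℓ (a, b) = inner ℝ p a + inner ℝ q b := by
      intro a b
      simp only [p, q, InnerProductSpace.toDual_symm_apply, ContinuousLinearMap.comp_apply,
        ContinuousLinearMap.inl_apply, ContinuousLinearMap.inr_apply]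
      rw [← map_add]
      simp
    have h1 : Tendsto (fun n => ℓ (u n, y n)) U (𝓝 (ℓ (f, z))) := by
      simp only [hpq]
      exact ((hu p).mono_left (hU.trans inf_le_left)).add (hz q)
    have h2 : ∀ᶠ n in (U : Filter ℕ), ℓ (u n, y n) ≤ r := by
      filter_upwards [hev] with n hn using (hl _ hn.1).le
    exact absurd hr (not_lt.2 (le_of_tendsto h1 h2))
  · simpa [z] using hφ

/-- Weak lower semicontinuity: if the liminf lies below `c`, graph partners of norm below `√c` exist
for infinitely many indices, and weak closedness of `G` hands the bound to the limit. -/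
theorem graphForm_le_liminf [CompleteSpace H] [CompleteSpace Y] {G : Submodule ℝ (H × Y)}
    (hG : IsClosed (G : Set (H × Y))) {u : ℕ → H} {f : H} (hu : WeaklyTendsto u f) :
    graphForm G f ≤ liminf (fun n => graphForm G (u n)) atTop := by
  refine le_of_forall_gt fun c hc => ?_
  obtain ⟨c', hc1, hc2⟩ := exists_between hc
  have h1 := frequently_lt_of_liminf_lt (by isBoundedDefault) hc1
  have h2 : ∀ n, ∃ y, graphForm G (u n) < c' → (u n, y) ∈ G ∧ ‖y‖ ≤ √ c'.toReal := by
    intro n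
    by_cases h : graphForm G (u n) < c'
    · have h' := h
      rw [graphForm] at h'
      simp only [iInf_lt_iff] at h'
      obtain ⟨y, hy, hlt⟩ := h'
      refine ⟨y, fun _ => ⟨hy, Real.le_sqrt_of_sq_le ?_⟩⟩
      have := ENNReal.toReal_mono hc2.ne_top hlt.le
      simpa using this
    · exact ⟨0, fun h' => absurd h' h⟩
  choose y hy using h2
  obtain ⟨z, hz, hzC⟩ := exists_mem_of_weaklyTendsto hG hu (h1.mono fun n hn => hy n hn)
  refine ((graphForm_le hz).trans ?_).trans_lt hc2
  have h3 : ‖z‖ ^ 2 ≤ c'.toReal := (Real.le_sqrt (norm_nonneg _) ENNReal.toReal_nonneg).1 hzC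
  rw [← ofReal_norm, ← ENNReal.ofReal_pow (norm_nonneg _)]
  exact ENNReal.ofReal_le_of_le_toReal h3

/-- Diagonal selection: take the largest `j ≤ n` for which `P j n` holds. -/
theorem exists_tendsto_of_forall_eventually {P : ℕ → ℕ → Prop} (h : ∀ j, ∀ᶠ n in atTop, P j n) :
    ∃ J : ℕ → ℕ, Tendsto J atTop atTop ∧ ∀ᶠ n in atTop, P (J n) n := by
  classical
  refine ⟨fun n => Nat.findGreatest (fun j => P j n) n, ?_, ?_⟩
  · refine tendsto_atTop.2 fun j => ?_
    filter_upwards [h j, eventually_ge_atTop j] with n hn hjn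
    exact Nat.le_findGreatest hjn hn
  · filter_upwards [h 0] with n hn
    exact Nat.findGreatest_spec (P := fun j => P j n) (Nat.zero_le n) hn

/-- A family of forms which decreases pointwise to the form of `G` Mosco converges to the form of
the closure of `G`. -/
theorem isMoscoLimitAtZero_graphForm [CompleteSpace H] [CompleteSpace Y]
    {G : Submodule ℝ (H × Y)} (hG : SingleValued G.topologicalClosure) {q : ℝ → H → ℝ≥0∞}
    (hle : ∀ l, 0 < l → ∀ f, graphForm G f ≤ q l f)
    (hlim : ∀ f c, graphForm G f < c → ∀ l : ℕ → ℝ, (∀ n, 0 < l n) → Tendsto l atTop (𝓝 0) →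
      ∀ᶠ n in atTop, q (l n) f ≤ c) :
    IsMoscoLimitAtZero q (graphForm G.topologicalClosure) := by
  intro l hl hl0
  have hanti : ∀ f, graphForm G.topologicalClosure f ≤ graphForm G f := fun f =>
    le_iInf₂ fun y hy => graphForm_le (G.le_topologicalClosure hy)
  refine ⟨fun u f hu => ?_, fun f => ?_⟩
  · refine (graphForm_le_liminf G.isClosed_topologicalClosure hu).trans ?_
    exact liminf_le_liminf (Eventually.of_forall fun n => (hanti _).trans (hle _ (hl n) _))
  · by_cases hf : graphForm G.topologicalClosure f < ⊤
    swap
    · exact ⟨fun _ => f, tendsto_const_nhds, by simp [not_lt_top_iff.1 hf]⟩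
    obtain ⟨g, hg⟩ := ((isFormClosure_graphForm hG).1 f).1 hf
    have hgl := (isFormClosure_graphForm hG).2 f g hg
    -- For each fixed `g j` the forms eventually come within `1 / (j + 1)` of the limit value; the
    -- diagonal sequence lets `j` grow with `n`.
    have h1 : ∀ j : ℕ, ∀ᶠ n in atTop, q (l n) (g j) ≤ graphForm G (g j) + 1 / ((j : ℝ≥0∞) + 1) := by
      intro j
      refine hlim _ _ ?_ l hl hl0
      exact ENNReal.lt_add_right (hg.mem_dom j).ne (by simp)
    obtain ⟨J, hJ, hP⟩ := exists_tendsto_of_forall_eventually h1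
    refine ⟨fun n => g (J n), hg.tendsto.comp hJ, ?_⟩
    have h2 : Tendsto (fun j : ℕ => graphForm G (g j) + 1 / ((j : ℝ≥0∞) + 1)) atTop
        (𝓝 (graphForm G.topologicalClosure f + 0)) := by
      refine hgl.add ?_
      have := (tendsto_add_atTop_iff_nat 1).2 ENNReal.tendsto_inv_nat_nhds_zero
      simpa using this
    rw [add_zero] at h2
    exact (limsup_le_limsup hP).trans (h2.comp hJ).limsup_eq.le

end Abstract

/-! ### The measures -/

theorem lintegral_m (f : ℝ → ℝ≥0∞) :
    ∫⁻ x, f x ∂m = ∫⁻ x in Ioi 0, ENNReal.ofReal (2 * x ^ 2) * f x := by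
  rw [m, lintegral_withDensity_eq_lintegral_mul_non_measurable₀ _ (by fun_prop)
    (Eventually.of_forall fun _ => ENNReal.ofReal_lt_top)]
  rfl

theorem lintegral_muAC (f : ℝ → ℝ≥0∞) :
    ∫⁻ x, f x ∂muAC = ∫⁻ x in Ioo 0 1, ENNReal.ofReal (x ^ 2) * f x := by
  rw [muAC, lintegral_withDensity_eq_lintegral_mul_non_measurable₀ _ (by fun_prop)
    (Eventually.of_forall fun _ => ENNReal.ofReal_lt_top)]
  rfl

theorem lintegral_mu (a : ℕ+ → ℝ) (f : ℝ → ℝ≥0∞) :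
    ∫⁻ x, f x ∂(mu a) = (∫⁻ x in Ioo 0 1, ENNReal.ofReal (x ^ 2) * f x) +
      ∑' k : ℕ+, ENNReal.ofReal (a k) * f k := by
  simp [mu, muDisc, lintegral_add_measure, lintegral_muAC, lintegral_sum_measure]

theorem ae_m_iff {p : ℝ → Prop} : (∀ᵐ x ∂m, p x) ↔ ∀ᵐ x, 0 < x → p x := by
  rw [m, ae_withDensity_iff (by fun_prop), ae_restrict_iff' measurableSet_Ioi]
  refine eventually_congr (Eventually.of_forall fun x => forall_congr' fun hx => ?_)
  have : 0 < 2 * x ^ 2 := mul_pos two_pos (pow_pos hx 2)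
  simp only [ne_eq, ENNReal.ofReal_eq_zero, not_le, this, true_imp_iff]

theorem ae_muAC_iff {p : ℝ → Prop} : (∀ᵐ x ∂muAC, p x) ↔ ∀ᵐ x, x ∈ Ioo (0 : ℝ) 1 → p x := by
  rw [muAC, ae_withDensity_iff (by fun_prop), ae_restrict_iff' measurableSet_Ioo]
  refine eventually_congr (Eventually.of_forall fun x => forall_congr' fun hx => ?_)
  have : 0 < x ^ 2 := pow_pos hx.1 2
  simp only [ne_eq, ENNReal.ofReal_eq_zero, not_le, this, true_imp_iff]

theorem ae_mu_iff {a : ℕ+ → ℝ} (ha : ∀ k, 0 < a k) {p : ℝ → Prop} :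
    (∀ᵐ x ∂(mu a), p x) ↔ (∀ᵐ x, x ∈ Ioo (0 : ℝ) 1 → p x) ∧ ∀ k : ℕ+, p k := by
  rw [mu, ae_add_measure_iff, ae_muAC_iff, muDisc, Measure.ae_sum_iff]
  refine and_congr_right fun _ => forall_congr' fun k => ?_
  rw [Measure.ae_ennreal_smul_measure_iff (by simpa using ha k), ae_dirac_eq]
  rfl

theorem aestronglyMeasurable_m {f : ℝ → ℝ} (hf : AEStronglyMeasurable f (volume.restrict (Ioi 0))) :
    AEStronglyMeasurable f m := hf.mono_ac (withDensity_absolutelyContinuous _ _)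

theorem aestronglyMeasurable_mu {a : ℕ+ → ℝ} {f : ℝ → ℝ}
    (hf : AEStronglyMeasurable f (volume.restrict (Ioo 0 1))) :
    AEStronglyMeasurable f (mu a) := by
  refine (hf.mono_ac (withDensity_absolutelyContinuous _ _)).add_measure ?_
  exact AEStronglyMeasurable.sum_measure fun k => aestronglyMeasurable_dirac.smul_measure _

/-- Where the density is bounded below, Lebesgue measure is dominated by the weighted measure. This
is how convergence in weighted `L²` controls integrals over intervals away from `0`. -/
theorem volume_restrict_le_of_withDensity {s t : Set ℝ} {w : ℝ → ℝ} {r : ℝ} (hw : Measurable w)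
    (hr : 0 < r) (hts : t ⊆ s) (h : ∀ x ∈ t, r ≤ w x) :
    volume.restrict t ≤ ENNReal.ofReal r⁻¹ •
      (volume.restrict s).withDensity fun x => ENNReal.ofReal (w x) := by
  refine Measure.le_iff.2 fun A hA => ?_
  rw [Measure.smul_apply, withDensity_apply _ hA, smul_eq_mul, Measure.restrict_restrict hA,
    Measure.restrict_apply hA]
  calc volume (A ∩ t) = ENNReal.ofReal r⁻¹ * ∫⁻ _ in A ∩ t, ENNReal.ofReal r := by
        rw [setLIntegral_const, ← mul_assoc, ← ENNReal.ofReal_mul (by positivity),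
          inv_mul_cancel₀ hr.ne']
        simp
    _ ≤ ENNReal.ofReal r⁻¹ * ∫⁻ x in A ∩ t, ENNReal.ofReal (w x) := by
        gcongr 1
        exact setLIntegral_mono (by fun_prop) fun x hx => ENNReal.ofReal_le_ofReal (h x hx.2)
    _ ≤ _ := by
        gcongr 1
        exact lintegral_mono_set (inter_subset_inter_right _ hts)

theorem volume_restrict_le_m {b : ℝ} (hb : 0 < b) (c : ℝ) :
    volume.restrict (Ioc b c) ≤ ENNReal.ofReal (2 * b ^ 2)⁻¹ • m :=
  volume_restrict_le_of_withDensity (by fun_prop) (by positivity)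
    (fun _ hx => hb.trans hx.1) fun x hx => by
      have := hx.1.le
      gcongr

theorem volume_restrict_le_mu (a : ℕ+ → ℝ) {b : ℝ} (hb : 0 < b) {c : ℝ} (hc : c ≤ 1) :
    volume.restrict (Ioc b c) ≤ ENNReal.ofReal (b ^ 2)⁻¹ • mu a := by
  rw [← restrict_Ioo_eq_restrict_Ioc]
  refine (volume_restrict_le_of_withDensity (s := Ioo 0 1) (w := fun x => x ^ 2) (r := b ^ 2)
    (by fun_prop) (by positivity) (Ioo_subset_Ioo hb.le hc) fun x hx => ?_).trans ?_
  · have := hx.1.le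
    change b ^ 2 ≤ x ^ 2
    gcongr
  · gcongr
    exact Measure.le_add_right le_rfl

theorem MemLp.integrable_of_le_smul {κ ν : Measure ℝ} [IsFiniteMeasure ν] {C : ℝ≥0∞} (hC : C ≠ ⊤)
    (hν : ν ≤ C • κ) {y : ℝ → ℝ} (hy : MemLp y 2 κ) : Integrable y ν :=
  ((hy.smul_measure hC).mono_measure hν).integrable (by norm_num)

/-- The comparison `ν ≤ C • κ` followed by Hölder on the finite measure `ν` turns `L²(κ)`
convergence into `L¹(ν)` convergence. -/
theorem tendsto_integral_of_tendsto_Lp {κ ν : Measure ℝ} [IsFiniteMeasure ν] {C : ℝ≥0∞}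
    (hC : C ≠ ⊤) (hν : ν ≤ C • κ) {y : ℕ → Lp ℝ 2 κ} {z : Lp ℝ 2 κ}
    (h : Tendsto y atTop (𝓝 z)) :
    Tendsto (fun n => ∫ x, y n x ∂ν) atTop (𝓝 (∫ x, z x ∂ν)) := by
  have hac : ν ≪ κ := (Measure.absolutelyContinuous_of_le hν).trans
    (Measure.smul_absolutelyContinuous)
  refine tendsto_integral_of_L1' _ ((Lp.aestronglyMeasurable z).mono_ac hac)
    (Eventually.of_forall fun n => MemLp.integrable_of_le_smul hC hν (Lp.memLp _)) ?_
  have h1 := (Lp.tendsto_Lp_iff_tendsto_eLpNorm' _ _).1 h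
  have h2 : ∀ n, eLpNorm (y n - z : ℝ → ℝ) 1 ν ≤
      C ^ (1 / 2 : ℝ) * eLpNorm (y n - z : ℝ → ℝ) 2 κ *
        ν univ ^ (1 / (1 : ℝ≥0∞).toReal - 1 / (2 : ℝ≥0∞).toReal) := by
    intro n
    have hm : AEStronglyMeasurable (y n - z : ℝ → ℝ) ν :=
      ((Lp.aestronglyMeasurable (y n)).sub (Lp.aestronglyMeasurable z)).mono_ac hac
    refine (eLpNorm_le_eLpNorm_mul_rpow_measure_univ one_le_two hm).trans ?_
    gcongr
    refine (eLpNorm_mono_measure _ hν).trans (le_of_eq ?_)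
    rw [eLpNorm_smul_measure_of_ne_top (by simp)]
    simp
  have h3 : Tendsto (fun n => C ^ (1 / 2 : ℝ) * eLpNorm (y n - z : ℝ → ℝ) 2 κ *
        ν univ ^ (1 / (1 : ℝ≥0∞).toReal - 1 / (2 : ℝ≥0∞).toReal)) atTop (𝓝 0) := by
    have e1 : C ^ (1 / 2 : ℝ) ≠ ⊤ := ENNReal.rpow_ne_top_of_nonneg (by norm_num) hC
    have e2 : ν univ ^ (1 / (1 : ℝ≥0∞).toReal - 1 / (2 : ℝ≥0∞).toReal) ≠ ⊤ :=
      ENNReal.rpow_ne_top_of_nonneg (by norm_num) (measure_ne_top _ _)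
    have := ENNReal.Tendsto.mul_const (ENNReal.Tendsto.const_mul h1 (Or.inr e1)) (Or.inr e2)
    simpa using this
  exact tendsto_of_tendsto_of_tendsto_of_le_of_le tendsto_const_nhds h3 (fun _ => zero_le) h2

theorem exists_subseq_ae_tendsto {κ : Measure ℝ} {y : ℕ → Lp ℝ 2 κ} {z : Lp ℝ 2 κ}
    (h : Tendsto y atTop (𝓝 z)) :
    ∃ ns : ℕ → ℕ, StrictMono ns ∧
      ∀ᵐ x ∂κ, Tendsto (fun i => y (ns i) x) atTop (𝓝 (z x)) :=
  (tendstoInMeasure_of_tendsto_Lp h).exists_seq_tendsto_ae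

theorem enorm_sq_Lp {κ : Measure ℝ} (y : Lp ℝ 2 κ) : ‖y‖ₑ ^ 2 = ∫⁻ x, ‖y x‖ₑ ^ 2 ∂κ := by
  rw [Lp.enorm_def, eLpNorm_eq_lintegral_rpow_enorm_toReal (by norm_num) (by norm_num),
    ← ENNReal.rpow_natCast, ← ENNReal.rpow_mul]
  simp

theorem memLp_two_iff {κ : Measure ℝ} {f : ℝ → ℝ} (hf : AEStronglyMeasurable f κ) :
    MemLp f 2 κ ↔ ∫⁻ x, ‖f x‖ₑ ^ 2 ∂κ < ⊤ := by
  rw [MemLp, and_iff_right hf,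
    eLpNorm_lt_top_iff_lintegral_rpow_enorm_lt_top (by norm_num) (by norm_num)]
  simp

theorem enorm_sq_eq_ofReal (x : ℝ) : ‖x‖ₑ ^ 2 = ENNReal.ofReal (x ^ 2) := by
  rw [Real.enorm_eq_ofReal_abs, ← ENNReal.ofReal_pow (abs_nonneg x), sq_abs]

/-! ### Local absolute continuity -/

theorem AbsolutelyContinuousOnInterval.congr {f g : ℝ → ℝ} {a b : ℝ}
    (hf : AbsolutelyContinuousOnInterval f a b) (h : EqOn f g (uIcc a b)) :
    AbsolutelyContinuousOnInterval g a b := by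
  rw [absolutelyContinuousOnInterval_iff] at hf ⊢
  intro ε hε
  obtain ⟨δ, hδ, H⟩ := hf ε hε
  refine ⟨δ, hδ, fun E hE hlt => ?_⟩
  convert H E hE hlt using 1
  refine Finset.sum_congr rfl fun i hi => ?_
  have := hE.1 i hi
  rw [h this.1, h this.2]

/-- `u` is locally absolutely continuous on `(0, ∞)`. -/
def LocAC (u : ℝ → ℝ) : Prop :=
  ∀ b c : ℝ, 0 < b → b ≤ c → AbsolutelyContinuousOnInterval u b c

theorem ae_differentiableAt_Ioo {ψ : ℝ → ℝ}
    (h : ∀ b : ℝ, 0 < b → b ≤ 1 → AbsolutelyContinuousOnInterval ψ b 1) :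
    ∀ᵐ x, x ∈ Ioo (0 : ℝ) 1 → DifferentiableAt ℝ ψ x := by
  have h1 : ∀ n : ℕ, ∀ᵐ x, x ∈ uIcc (1 / ((n : ℝ) + 1)) 1 → DifferentiableAt ℝ ψ x := fun n =>
    (h _ Nat.one_div_pos_of_nat (by
      rw [div_le_one (by positivity)]; simp)).ae_differentiableAt
  filter_upwards [ae_all_iff.2 h1] with x hx hx0
  obtain ⟨n, hn⟩ := exists_nat_one_div_lt hx0.1
  exact hx n (mem_uIcc.2 (Or.inl ⟨hn.le, hx0.2.le⟩))

theorem LocAC.ae_differentiableAt {u : ℝ → ℝ} (h : LocAC u) :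
    ∀ᵐ x, 0 < x → DifferentiableAt ℝ u x := by
  have h1 : ∀ n : ℕ, ∀ᵐ x, x ∈ uIcc (1 / ((n : ℝ) + 1)) (n + 1) → DifferentiableAt ℝ u x := fun n =>
    (h _ _ Nat.one_div_pos_of_nat (by
      rw [div_le_iff₀ (by positivity)]; nlinarith [n.cast_nonneg (α := ℝ)])).ae_differentiableAt
  filter_upwards [ae_all_iff.2 h1] with x hx hx0
  obtain ⟨n, hn⟩ := exists_nat_one_div_lt hx0
  obtain ⟨k, hk⟩ := exists_nat_gt x
  refine hx (max n k) (mem_uIcc.2 (Or.inl ⟨le_trans ?_ hn.le, hk.le.trans ?_⟩))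
  · gcongr; exact le_max_left _ _
  · have : (k : ℝ) ≤ ((max n k : ℕ) : ℝ) := by exact_mod_cast le_max_right n k
    linarith

theorem locAC_integral {g : ℝ → ℝ}
    (hg : ∀ b c : ℝ, 0 < b → b ≤ c → IntervalIntegrable g volume b c) (C : ℝ) {x₀ : ℝ}
    (hx₀ : 0 < x₀) : LocAC fun x => C + ∫ t in x₀..x, g t := by
  intro b c hb hbc
  -- The interval is enlarged so that it contains the base point `x₀`.
  have h1 := (hg (min b x₀) (max c x₀) (lt_min hb hx₀)
    (by simp)).absolutelyContinuousOnInterval_intervalIntegral (c := x₀) (by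
      rw [uIcc_of_le (by simp)]; simp)
  have h2 : AbsolutelyContinuousOnInterval (fun x => ∫ t in x₀..x, g t) b c := by
    refine h1.mono ?_
    rw [uIcc_of_le hbc, uIcc_of_le (by simp)]
    exact Icc_subset_Icc (min_le_left _ _) (le_max_left _ _)
  have h3 : AbsolutelyContinuousOnInterval (fun _ : ℝ => C) b c :=
    ((LipschitzWith.const C).lipschitzOnWith).absolutelyContinuousOnInterval
  exact h3.add h2

theorem ae_hasDerivAt_integral {g : ℝ → ℝ}
    (hg : ∀ b c : ℝ, 0 < b → b ≤ c → IntervalIntegrable g volume b c) (C : ℝ) {x₀ : ℝ}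
    (hx₀ : 0 < x₀) : ∀ᵐ x, 0 < x → HasDerivAt (fun x => C + ∫ t in x₀..x, g t) (g x) x := by
  have h1 : ∀ n : ℕ, ∀ᵐ x, x ∈ uIcc (min (1 / ((n : ℝ) + 1)) x₀) (max (n + 1) x₀) →
      HasDerivAt (fun x => ∫ t in x₀..x, g t) (g x) x := by
    intro n
    have hle : min (1 / ((n : ℝ) + 1)) x₀ ≤ max ((n : ℝ) + 1) x₀ := by simp
    have := (hg (min (1 / ((n : ℝ) + 1)) x₀) (max (n + 1) x₀)
      (lt_min Nat.one_div_pos_of_nat hx₀) hle).ae_hasDerivAt_integral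
    filter_upwards [this] with x hx hxm
    exact hx hxm x₀ (by rw [uIcc_of_le hle]; simp)
  filter_upwards [ae_all_iff.2 h1] with x hx hx0
  obtain ⟨n, hn⟩ := exists_nat_one_div_lt hx0
  obtain ⟨k, hk⟩ := exists_nat_gt x
  refine HasDerivAt.const_add C (hx (max n k) (mem_uIcc.2 (Or.inl ⟨?_, ?_⟩)))
  · refine (min_le_left _ _).trans (le_trans ?_ hn.le)
    gcongr; exact le_max_left _ _
  · have : (k : ℝ) ≤ ((max n k : ℕ) : ℝ) := by exact_mod_cast le_max_right n k
    exact le_max_of_le_left (by linarith)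

theorem intervalIntegrable_of_memLp_m {g : ℝ → ℝ} (hg : MemLp g 2 m) {b c : ℝ} (hb : 0 < b)
    (hbc : b ≤ c) : IntervalIntegrable g volume b c :=
  (intervalIntegrable_iff_integrableOn_Ioc_of_le hbc).2
    (MemLp.integrable_of_le_smul ENNReal.ofReal_ne_top (volume_restrict_le_m hb c) hg)

theorem tendsto_intervalIntegral_m {y : ℕ → Lp ℝ 2 m} {z : Lp ℝ 2 m} (h : Tendsto y atTop (𝓝 z))
    {b c : ℝ} (hb : 0 < b) (hc : 0 < c) :
    Tendsto (fun n => ∫ x in b..c, y n x) atTop (𝓝 (∫ x in b..c, z x)) := by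
  simp only [intervalIntegral]
  exact (tendsto_integral_of_tendsto_Lp ENNReal.ofReal_ne_top (volume_restrict_le_m hb c) h).sub
    (tendsto_integral_of_tendsto_Lp ENNReal.ofReal_ne_top (volume_restrict_le_m hc b) h)

/-! ### The graph of the gradient on the maximal domain -/

/-- The jump intensities `k (k + 1)`. -/
def jc (k : ℕ+) : ℝ := (k : ℝ) * ((k : ℝ) + 1)

theorem jc_pos (k : ℕ+) : 0 < jc k := by
  have : (0 : ℝ) < k := by exact_mod_cast k.pos
  unfold jc; positivity

theorem one_le_pnat (k : ℕ+) : (1 : ℝ) ≤ k := by exact_mod_cast k.pos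

/-- The derivative of `ψ` on `(0, 1)` and its increments on `ℕ`. -/
noncomputable def grad (ψ : ℝ → ℝ) (x : ℝ) : ℝ := if x < 1 then deriv ψ x else ψ (x + 1) - ψ x

theorem grad_of_lt {ψ : ℝ → ℝ} {x : ℝ} (hx : x < 1) : grad ψ x = deriv ψ x := if_pos hx

theorem grad_pnat (ψ : ℝ → ℝ) (k : ℕ+) : grad ψ k = ψ ((k : ℝ) + 1) - ψ k :=
  if_neg (not_lt.2 (one_le_pnat k))

theorem aestronglyMeasurable_grad (ψ : ℝ → ℝ) (a : ℕ+ → ℝ) :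
    AEStronglyMeasurable (grad ψ) (mu a) := by
  refine aestronglyMeasurable_mu ?_
  refine (stronglyMeasurable_deriv ψ).aestronglyMeasurable.congr ?_
  filter_upwards [ae_restrict_mem measurableSet_Ioo] with x hx using (grad_of_lt hx.2).symm

/-- The weights `jc` are chosen for this identity, which makes both energies together a single
squared `L²` norm. -/
theorem lintegral_grad (ψ : ℝ → ℝ) :
    ∫⁻ x, ‖grad ψ x‖ₑ ^ 2 ∂(mu jc) = contEnergy ψ + jumpEnergy ψ := by
  rw [lintegral_mu]
  congr 1
  · refine setLIntegral_congr_fun measurableSet_Ioo fun x hx => ?_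
    simp only [grad_of_lt hx.2, enorm_sq_eq_ofReal]
    rw [← ENNReal.ofReal_mul (by positivity), mul_comm]
  · refine tsum_congr fun k => ?_
    rw [grad_pnat, enorm_sq_eq_ofReal, ← ENNReal.ofReal_mul (jc_pos k).le, jc]

theorem memLp_grad_iff {ψ : ℝ → ℝ} :
    MemLp (grad ψ) 2 (mu jc) ↔ contEnergy ψ + jumpEnergy ψ < ⊤ := by
  rw [memLp_two_iff (aestronglyMeasurable_grad ψ jc), lintegral_grad]

theorem grad_add {ψ φ : ℝ → ℝ}
    (hψ : ∀ b : ℝ, 0 < b → b ≤ 1 → AbsolutelyContinuousOnInterval ψ b 1)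
    (hφ : ∀ b : ℝ, 0 < b → b ≤ 1 → AbsolutelyContinuousOnInterval φ b 1) :
    grad (ψ + φ) =ᵐ[mu jc] grad ψ + grad φ := by
  refine (ae_mu_iff jc_pos).2 ⟨?_, fun k => ?_⟩
  · filter_upwards [ae_differentiableAt_Ioo hψ, ae_differentiableAt_Ioo hφ] with x h1 h2 hx
    simp only [Pi.add_apply, grad_of_lt hx.2, deriv_add (h1 hx) (h2 hx)]
  · simp only [Pi.add_apply, grad_pnat]; ring

theorem grad_const_smul (ψ : ℝ → ℝ) (c : ℝ) : grad (c • ψ) = c • grad ψ := by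
  ext x
  by_cases h : x < 1
  · simp [grad_of_lt h, deriv_const_smul_field]
  · simp [grad, h, mul_sub]

theorem IsACVersion.add {a : ℕ+ → ℝ} {f g : L2 a} {ψ φ : ℝ → ℝ} (hf : IsACVersion a f ψ)
    (hg : IsACVersion a g φ) : IsACVersion a (f + g) (ψ + φ) :=
  ⟨(Lp.coeFn_add f g).trans (hf.1.add hg.1), fun b h0 h1 => (hf.2 b h0 h1).add (hg.2 b h0 h1)⟩

theorem IsACVersion.const_smul {a : ℕ+ → ℝ} {f : L2 a} {ψ : ℝ → ℝ} (hf : IsACVersion a f ψ)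
    (c : ℝ) : IsACVersion a (c • f) (c • ψ) :=
  ⟨(Lp.coeFn_smul c f).trans (hf.1.const_smul c), fun b h0 h1 => (hf.2 b h0 h1).const_smul c⟩

/-- The graph of the gradient on the maximal domain. -/
def gradGraph (a : ℕ+ → ℝ) : Submodule ℝ (L2 a × L2 jc) where
  carrier := {p | ∃ ψ, IsACVersion a p.1 ψ ∧ p.2 =ᵐ[mu jc] grad ψ}
  add_mem' := by
    rintro p q ⟨ψ, hψ, hp⟩ ⟨φ, hφ, hq⟩
    refine ⟨ψ + φ, hψ.add hφ, (Lp.coeFn_add p.2 q.2).trans ((hp.add hq).trans ?_)⟩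
    exact (grad_add hψ.2 hφ.2).symm
  zero_mem' := by
    refine ⟨0, ⟨Lp.coeFn_zero _ _ _, fun b h0 h1 => ?_⟩, (Lp.coeFn_zero _ _ _).trans ?_⟩
    · exact ((LipschitzWith.const (0 : ℝ)).lipschitzOnWith).absolutelyContinuousOnInterval
    · have : grad 0 = 0 := by simpa using grad_const_smul 0 0
      rw [this]
  smul_mem' := by
    rintro c p ⟨ψ, hψ, hp⟩
    refine ⟨c • ψ, hψ.const_smul c, (Lp.coeFn_smul c p.2).trans ?_⟩
    rw [grad_const_smul]
    exact hp.const_smul c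

theorem mem_gradGraph {a : ℕ+ → ℝ} {f : L2 a} {y : L2 jc} :
    (f, y) ∈ gradGraph a ↔ ∃ ψ, IsACVersion a f ψ ∧ y =ᵐ[mu jc] grad ψ := Iff.rfl

theorem mem_gradGraph_toLp {a : ℕ+ → ℝ} {f : L2 a} {ψ : ℝ → ℝ} (h : IsACVersion a f ψ)
    (hψ : MemLp (grad ψ) 2 (mu jc)) : (f, hψ.toLp _) ∈ gradGraph a := ⟨ψ, h, hψ.coeFn_toLp⟩

theorem mem_maxDom_iff {a : ℕ+ → ℝ} {f : L2 a} : f ∈ maxDom a ↔ ∃ y, (f, y) ∈ gradGraph a := by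
  constructor
  · rintro ⟨ψ, hψ, hlt⟩
    exact ⟨_, mem_gradGraph_toLp hψ (memLp_grad_iff.2 hlt)⟩
  · rintro ⟨y, ψ, hψ, hy⟩
    exact ⟨ψ, hψ, memLp_grad_iff.1 ((memLp_congr_ae hy).1 (Lp.memLp y))⟩

theorem enorm_sq_of_ae_eq_grad {y : L2 jc} {ψ : ℝ → ℝ} (h : y =ᵐ[mu jc] grad ψ) :
    ‖y‖ₑ ^ 2 = contEnergy ψ + jumpEnergy ψ := by
  rw [enorm_sq_Lp, ← lintegral_grad]
  exact lintegral_congr_ae (h.mono fun x hx => by simp only [hx])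

/-- The energies do not depend on the version, so any version of zero has the energy of the zero
function. -/
theorem singleValued_gradGraph {a : ℕ+ → ℝ} (ha : ∀ k, 0 < a k) : SingleValued (gradGraph a) := by
  rintro y ⟨ψ, hψ, hy⟩
  have h0 : IsACVersion a (0 : L2 a) 0 :=
    ⟨Lp.coeFn_zero _ _ _, fun b _ _ =>
      ((LipschitzWith.const (0 : ℝ)).lipschitzOnWith).absolutelyContinuousOnInterval⟩
  have hE := enorm_sq_of_ae_eq_grad hy
  rw [← contForm_eq hψ, ← jumpForm_eq ha hψ, contForm_eq h0, jumpForm_eq ha h0] at hE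
  simpa [contEnergy, jumpEnergy] using hE

theorem Q_eq_graphForm {a : ℕ+ → ℝ} (ha : ∀ k, 0 < a k) : Q a = graphForm (gradGraph a) := by
  ext f
  by_cases hf : f ∈ maxDom a
  · obtain ⟨y, hy⟩ := mem_maxDom_iff.1 hf
    rw [graphForm_eq (singleValued_gradGraph ha) hy, Q, restrictForm, iInf_pos hf]
    obtain ⟨ψ, hψ, hy⟩ := hy
    rw [contForm_eq hψ, jumpForm_eq ha hψ, enorm_sq_of_ae_eq_grad hy]
  · have h := mt graphForm_lt_top_iff.1 (mt mem_maxDom_iff.2 hf)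
    rw [not_lt_top_iff.1 h, Q, restrictForm, iInf_neg hf]

theorem IsACVersion.sub_eq_integral {a : ℕ+ → ℝ} {f : L2 a} {ψ : ℝ → ℝ} (hψ : IsACVersion a f ψ)
    {y : L2 jc} (hy : y =ᵐ[mu jc] grad ψ) {x : ℝ} (hx : x ∈ Ioc 0 1) :
    ψ 1 - ψ x = ∫ t in Ioc x 1, y t := by
  rw [← (hψ.2 x hx.1 hx.2).integral_deriv_eq_sub, intervalIntegral.integral_of_le hx.2,
    integral_Ioc_eq_integral_Ioo, integral_Ioc_eq_integral_Ioo]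
  refine setIntegral_congr_ae measurableSet_Ioo ?_
  filter_upwards [((ae_mu_iff jc_pos).1 hy).1] with t ht htx
  rw [ht ⟨hx.1.trans htx.1, htx.2⟩, grad_of_lt htx.2]

/-- Convergence at the atoms includes convergence at `1`, and the derivatives converge in `L¹` on
each `(x, 1]`. Hence the versions converge pointwise on `(0, 1]` to a primitive anchored at `f 1`,
and the increments converge as well. -/
theorem isClosed_gradGraph {a : ℕ+ → ℝ} (ha : ∀ k, 0 < a k) :
    IsClosed (gradGraph a : Set (L2 a × L2 jc)) := by
  refine IsSeqClosed.isClosed fun p q hp hq => ?_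
  obtain ⟨f, y⟩ := q
  have hf : Tendsto (fun n => (p n).1) atTop (𝓝 f) := (continuous_fst.tendsto _).comp hq
  have hy : Tendsto (fun n => (p n).2) atTop (𝓝 y) := (continuous_snd.tendsto _).comp hq
  choose ψ hψ hg using hp
  obtain ⟨ns, hns, h1⟩ := exists_subseq_ae_tendsto hf
  obtain ⟨ms, hms, h2⟩ := exists_subseq_ae_tendsto (hy.comp hns.tendsto_atTop)
  have h1 := (ae_mu_iff ha).1 h1
  have h2 := (ae_mu_iff jc_pos).1 h2
  have hk : ∀ k : ℕ+, Tendsto (fun i => ψ (ns i) k) atTop (𝓝 (f k)) := fun k =>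
    (h1.2 k).congr fun i => ((ae_mu_iff ha).1 (hψ (ns i)).1).2 k
  have hk1 := hk 1
  simp only [PNat.one_coe, Nat.cast_one] at hk1
  -- Cutting `y` off beyond `1` makes it integrable on all compact subintervals of `(0, ∞)`, as the
  -- lemmas on primitives require.
  let g : ℝ → ℝ := (Ioc (0 : ℝ) 1).indicator y
  have hgi : ∀ b c : ℝ, 0 < b → b ≤ c → IntervalIntegrable g volume b c := by
    intro b c hb hbc
    rw [intervalIntegrable_iff_integrableOn_Ioc_of_le hbc, IntegrableOn,
      integrable_indicator_iff measurableSet_Ioc, IntegrableOn,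
      Measure.restrict_restrict measurableSet_Ioc]
    refine Integrable.mono_measure (MemLp.integrable_of_le_smul ENNReal.ofReal_ne_top
      (volume_restrict_le_mu jc hb le_rfl) (Lp.memLp y)) ?_
    exact Measure.restrict_mono_set _ fun x hx => ⟨hx.2.1, hx.1.2⟩
  let φ : ℝ → ℝ := fun x => f 1 + ∫ t in (1 : ℝ)..x, g t
  have hφ := locAC_integral hgi (f 1) one_pos
  have hφd := ae_hasDerivAt_integral hgi (f 1) one_pos
  have hint : ∀ x ∈ Ioc (0 : ℝ) 1, φ x = f 1 - ∫ t in Ioc x 1, y t := by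
    intro x hx
    simp only [φ]
    rw [intervalIntegral.integral_symm, intervalIntegral.integral_of_le hx.2, ← sub_eq_add_neg]
    congr 1
    refine setIntegral_congr_fun measurableSet_Ioc fun t ht => ?_
    exact indicator_of_mem (show t ∈ Ioc (0 : ℝ) 1 from ⟨hx.1.trans ht.1, ht.2⟩) _
  have hlim : ∀ x ∈ Ioc (0 : ℝ) 1, Tendsto (fun i => ψ (ns i) x) atTop (𝓝 (φ x)) := by
    intro x hx
    rw [hint x hx]
    have := tendsto_integral_of_tendsto_Lp ENNReal.ofReal_ne_top
      (volume_restrict_le_mu jc hx.1 le_rfl) (hy.comp hns.tendsto_atTop)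
    refine (hk1.sub this).congr fun i => ?_
    rw [Function.comp_apply, ← (hψ (ns i)).sub_eq_integral (hg (ns i)) hx, sub_sub_cancel]
  -- The version of the limit is glued from the primitive on `(0, 1]` and `f` beyond; at the atom
  -- `1` the two agree.
  let χ : ℝ → ℝ := fun x => if x ≤ 1 then φ x else f x
  have hχ1 : χ 1 = f 1 := by simp [χ, φ]
  have hχk : ∀ k : ℕ+, χ k = f k := by
    intro k
    rcases (one_le_pnat k).eq_or_lt with h | h
    · rw [← h, hχ1]
    · exact if_neg (not_le.2 h)
  refine ⟨χ, ⟨(ae_mu_iff ha).2 ⟨?_, fun k => (hχk k).symm⟩, fun b h0 h1 => ?_⟩,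
    (ae_mu_iff jc_pos).2 ⟨?_, fun k => ?_⟩⟩
  · have hall : ∀ᵐ x, ∀ i, x ∈ Ioo (0 : ℝ) 1 → (p (ns i)).1 x = ψ (ns i) x :=
      ae_all_iff.2 fun i => ((ae_mu_iff ha).1 (hψ (ns i)).1).1
    filter_upwards [h1.1, hall] with x hx hx2 hx0
    have e : χ x = φ x := if_pos hx0.2.le
    rw [e]
    refine tendsto_nhds_unique (hx hx0) ((hlim x ⟨hx0.1, hx0.2.le⟩).congr fun i => ?_)
    rw [hx2 i hx0]
  · refine AbsolutelyContinuousOnInterval.congr (hφ b 1 h0 h1) fun x hx => ?_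
    rw [uIcc_of_le h1] at hx
    exact (if_pos hx.2).symm
  · filter_upwards [hφd] with x hx hx0
    rw [grad_of_lt hx0.2]
    have e : χ =ᶠ[𝓝 x] φ := by
      filter_upwards [Iio_mem_nhds hx0.2] with t ht using if_pos (le_of_lt ht)
    rw [e.deriv_eq, (hx hx0.1).deriv]
    exact (indicator_of_mem (show x ∈ Ioc (0 : ℝ) 1 from ⟨hx0.1, hx0.2.le⟩) _).symm
  · rw [grad_pnat]
    have e := hχk (k + 1)
    have hk2 := hk (k + 1)
    push_cast at e hk2
    rw [e, hχk k]
    refine tendsto_nhds_unique (h2.2 k) (((hk2.sub (hk k)).comp hms.tendsto_atTop).congr fun i => ?_)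
    have := ((ae_mu_iff jc_pos).1 (hg (ns (ms i)))).2 k
    simp only [Function.comp_apply]
    rw [this, grad_pnat]

/-! ### The domain of the Bessel form -/

/-- `∫_s u'(x)² x² dx`. -/
noncomputable def energyOn (u : ℝ → ℝ) (s : Set ℝ) : ℝ≥0∞ :=
  ∫⁻ x in s, ENNReal.ofReal (deriv u x ^ 2 * x ^ 2)

theorem lintegral_deriv_m (u : ℝ → ℝ) :
    ∫⁻ x, ‖deriv u x‖ₑ ^ 2 ∂m = 2 * energyOn u (Ioi 0) := by
  rw [lintegral_m, energyOn, ← lintegral_const_mul _ (by fun_prop)]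
  refine lintegral_congr fun x => ?_
  have h2 : (2 : ℝ≥0∞) = ENNReal.ofReal 2 := by simp
  rw [enorm_sq_eq_ofReal, h2, ← ENNReal.ofReal_mul (by positivity), ← ENNReal.ofReal_mul two_pos.le]
  congr 1; ring

theorem aestronglyMeasurable_deriv (u : ℝ → ℝ) (κ : Measure ℝ) :
    AEStronglyMeasurable (deriv u) κ := (stronglyMeasurable_deriv u).aestronglyMeasurable

theorem memLp_deriv_iff {u : ℝ → ℝ} : MemLp (deriv u) 2 m ↔ energyOn u (Ioi 0) < ⊤ := by
  rw [memLp_two_iff (aestronglyMeasurable_deriv u _), lintegral_deriv_m]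
  simp [lt_top_iff_ne_top, ENNReal.mul_eq_top]

theorem inDom_iff {u : ℝ → ℝ} : InDom u ↔ LocAC u ∧ MemLp (deriv u) 2 m ∧ MemLp u 2 m := by
  rw [memLp_deriv_iff]
  exact ⟨fun h => ⟨h.ac, h.energy, h.memLp⟩, fun h => ⟨h.1, h.2.1, h.2.2⟩⟩

theorem InDom.locAC {u : ℝ → ℝ} (h : InDom u) : LocAC u := h.ac

theorem InDom.memLp_deriv {u : ℝ → ℝ} (h : InDom u) : MemLp (deriv u) 2 m := (inDom_iff.1 h).2.1

theorem LocAC.deriv_add {u v : ℝ → ℝ} (hu : LocAC u) (hv : LocAC v) :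
    deriv (u + v) =ᵐ[m] deriv u + deriv v := by
  refine ae_m_iff.2 ?_
  filter_upwards [hu.ae_differentiableAt, hv.ae_differentiableAt] with x h1 h2 hx
  rw [_root_.deriv_add (h1 hx) (h2 hx), Pi.add_apply]

theorem deriv_smul_eq (c : ℝ) (u : ℝ → ℝ) : deriv (c • u) = c • deriv u := by
  ext x
  simp [deriv_const_smul_field]

theorem InDom.add {u v : ℝ → ℝ} (hu : InDom u) (hv : InDom v) : InDom (u + v) :=
  inDom_iff.2 ⟨fun b c hb hc => (hu.ac b c hb hc).add (hv.ac b c hb hc),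
    (memLp_congr_ae (hu.locAC.deriv_add hv.locAC)).2 (hu.memLp_deriv.add hv.memLp_deriv),
    hu.memLp.add hv.memLp⟩

theorem InDom.smul {u : ℝ → ℝ} (hu : InDom u) (c : ℝ) : InDom (c • u) :=
  inDom_iff.2 ⟨fun b d hb hd => (hu.ac b d hb hd).const_smul c,
    (deriv_smul_eq c u) ▸ hu.memLp_deriv.const_smul c, hu.memLp.const_smul c⟩

theorem InDom.sub {u v : ℝ → ℝ} (hu : InDom u) (hv : InDom v) : InDom (u - v) := by
  have : u - v = u + (-1 : ℝ) • v := by ext; simp [sub_eq_add_neg]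
  rw [this]
  exact hu.add (hv.smul _)

theorem InDom.zero : InDom 0 :=
  inDom_iff.2 ⟨fun _ _ _ _ =>
    ((LipschitzWith.const (0 : ℝ)).lipschitzOnWith).absolutelyContinuousOnInterval,
    by
      have : deriv (0 : ℝ → ℝ) = 0 := by ext; simp
      rw [this]; exact MemLp.zero, MemLp.zero⟩

theorem LocAC.deriv_sub {u v : ℝ → ℝ} (hu : LocAC u) (hv : LocAC v) :
    deriv (u - v) =ᵐ[m] deriv u - deriv v := by
  refine ae_m_iff.2 ?_
  filter_upwards [hu.ae_differentiableAt, hv.ae_differentiableAt] with x h1 h2 hx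
  rw [_root_.deriv_sub (h1 hx) (h2 hx), Pi.sub_apply]

/-! ### The range of the restriction operator -/

theorem IsRestriction.isACVersion {a : ℕ+ → ℝ} {u : ℝ → ℝ} {f : L2 a} (h : IsRestriction a u f) :
    IsACVersion a f u := ⟨h.2, fun b hb hb1 => h.1.ac b 1 hb hb1⟩

/-- The range of `J` as a submodule. -/
noncomputable def ranJSubmodule (a : ℕ+ → ℝ) : Submodule ℝ (L2 a) where
  carrier := ranJ a
  add_mem' := by
    rintro f g ⟨u, hu, hf⟩ ⟨v, hv, hg⟩
    exact ⟨u + v, hu.add hv, (Lp.coeFn_add f g).trans (hf.add hg)⟩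
  zero_mem' := ⟨0, InDom.zero, Lp.coeFn_zero _ _ _⟩
  smul_mem' := by
    rintro c f ⟨u, hu, hf⟩
    exact ⟨c • u, hu.smul c, (Lp.coeFn_smul c f).trans (hf.const_smul c)⟩

/-- The graph of the gradient on the range of `J`. -/
noncomputable def ranJGraph (a : ℕ+ → ℝ) : Submodule ℝ (L2 a × L2 jc) :=
  gradGraph a ⊓ (ranJSubmodule a).comap (LinearMap.fst ℝ _ _)

theorem mem_ranJGraph {a : ℕ+ → ℝ} {f : L2 a} {y : L2 jc} :
    (f, y) ∈ ranJGraph a ↔ (f, y) ∈ gradGraph a ∧ f ∈ ranJ a := Iff.rfl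

theorem ranJGraph_le (a : ℕ+ → ℝ) : ranJGraph a ≤ gradGraph a := inf_le_left

theorem closure_ranJGraph_le {a : ℕ+ → ℝ} (ha : ∀ k, 0 < a k) :
    (ranJGraph a).topologicalClosure ≤ gradGraph a :=
  Submodule.topologicalClosure_minimal _ (ranJGraph_le a) (isClosed_gradGraph ha)

theorem singleValued_closure_ranJGraph {a : ℕ+ → ℝ} (ha : ∀ k, 0 < a k) :
    SingleValued (ranJGraph a).topologicalClosure :=
  (singleValued_gradGraph ha).mono (closure_ranJGraph_le ha)

theorem restrictForm_Q_ranJ {a : ℕ+ → ℝ} (ha : ∀ k, 0 < a k) :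
    restrictForm (Q a) (ranJ a) = graphForm (ranJGraph a) := by
  rw [Q_eq_graphForm ha]
  ext f
  by_cases hf : f ∈ ranJ a
  · simp [restrictForm, graphForm, mem_ranJGraph, hf]
  · simp [restrictForm, graphForm, mem_ranJGraph, hf]

/-! ### The energy of the increments -/

theorem intervalIntegrable_inv_sq {b c : ℝ} (hb : 0 < b) (hc : 0 < c) :
    IntervalIntegrable (fun t : ℝ => (t ^ 2)⁻¹) volume b c := by
  refine ContinuousOn.intervalIntegrable fun t ht => ?_
  have : 0 < t := (lt_min hb hc).trans_le ht.1
  exact ((continuousAt_id.pow 2).inv₀ (pow_pos this 2).ne').continuousWithinAt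

theorem integral_inv_sq {b c : ℝ} (hb : 0 < b) (hc : 0 < c) :
    ∫ t in b..c, (t ^ 2)⁻¹ = b⁻¹ - c⁻¹ := by
  have := intervalIntegral.integral_eq_sub_of_hasDerivAt (f := fun t : ℝ => -t⁻¹)
    (f' := fun t => (t ^ 2)⁻¹) (fun t ht => ?_) (intervalIntegrable_inv_sq hb hc)
  · rw [this]; ring
  · have h0 : t ≠ 0 := ((lt_min hb hc).trans_le ht.1).ne'
    simpa using! (hasDerivAt_inv h0).neg

theorem ofReal_integral_le_lintegral_ofReal {κ : Measure ℝ} {f : ℝ → ℝ} (hf : Integrable f κ) :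
    ENNReal.ofReal (∫ x, f x ∂κ) ≤ ∫⁻ x, ENNReal.ofReal (f x) ∂κ := by
  rw [integral_eq_lintegral_pos_part_sub_lintegral_neg_part hf]
  refine (ENNReal.ofReal_le_ofReal (sub_le_self _ ENNReal.toReal_nonneg)).trans ?_
  exact ENNReal.ofReal_toReal_le

/-- Complete the square against the harmonic competitor, whose derivative is `C / t²`; the constant
`C` is the one for which this integrates to `u c - u b` over `(b, c)`. For `b = k`, `c = k + 1` the
factor is `k (k + 1)`. -/
theorem LocAC.ofReal_le_energyOn {u : ℝ → ℝ} (hu : LocAC u) {b c : ℝ} (hb : 0 < b) (hbc : b < c) :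
    ENNReal.ofReal (b * c / (c - b) * (u c - u b) ^ 2) ≤ energyOn u (Ioo b c) := by
  have hc := hb.trans hbc
  have hac := hu b c hb hbc.le
  set C : ℝ := b * c / (c - b) * (u c - u b) with hC
  have h1 := hac.intervalIntegrable_deriv.const_mul (2 * C)
  have h2 := (intervalIntegrable_inv_sq hb hc).const_mul (C ^ 2)
  have h3 : ∫ t in b..c, (2 * C * deriv u t - C ^ 2 * (t ^ 2)⁻¹) =
      b * c / (c - b) * (u c - u b) ^ 2 := by
    rw [intervalIntegral.integral_sub h1 h2, intervalIntegral.integral_const_mul,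
      intervalIntegral.integral_const_mul, hac.integral_deriv_eq_sub, integral_inv_sq hb hc, hC]
    have : c - b ≠ 0 := (sub_pos.2 hbc).ne'
    field_simp
    ring
  rw [← h3, intervalIntegral.integral_of_le hbc.le, energyOn, restrict_Ioo_eq_restrict_Ioc]
  refine (ofReal_integral_le_lintegral_ofReal
    ((intervalIntegrable_iff_integrableOn_Ioc_of_le hbc.le).1 (h1.sub h2))).trans ?_
  refine setLIntegral_mono' measurableSet_Ioc fun t ht => ENNReal.ofReal_le_ofReal ?_
  have h0 : t ≠ 0 := (hb.trans ht.1).ne'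
  have h4 : 0 ≤ (deriv u t * t - C * t⁻¹) ^ 2 := sq_nonneg _
  have h5 : (deriv u t * t - C * t⁻¹) ^ 2 =
      deriv u t ^ 2 * t ^ 2 - (2 * C * deriv u t - C ^ 2 * (t ^ 2)⁻¹) := by
    field_simp
    ring
  linarith

theorem pairwise_disjoint_Ioo_pnat :
    Pairwise (Function.onFun Disjoint fun k : ℕ+ => Ioo (k : ℝ) ((k : ℝ) + 1)) := by
  intro j k hjk
  refine Set.disjoint_left.2 fun x hj hk => hjk ?_
  have h1 : (j : ℝ) < k + 1 := hj.1.trans hk.2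
  have h2 : (k : ℝ) < j + 1 := hk.1.trans hj.2
  have h3 : (j : ℕ) < k + 1 := by exact_mod_cast h1
  have h4 : (k : ℕ) < j + 1 := by exact_mod_cast h2
  exact PNat.eq (by omega)

/-- The lower bound for all extensions: apply the variational inequality on the disjoint intervals
`(k, k + 1)` and keep the energy on `(0, 1)`. -/
theorem LocAC.contEnergy_add_jumpEnergy_le {u : ℝ → ℝ} (hu : LocAC u) :
    contEnergy u + jumpEnergy u ≤ energyOn u (Ioi 0) := by
  have h1 : jumpEnergy u ≤ energyOn u (⋃ k : ℕ+, Ioo (k : ℝ) ((k : ℝ) + 1)) := by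
    rw [energyOn, lintegral_iUnion (fun _ => measurableSet_Ioo) pairwise_disjoint_Ioo_pnat]
    refine ENNReal.tsum_le_tsum fun k => ?_
    have := hu.ofReal_le_energyOn (zero_lt_one.trans_le (one_le_pnat k)) (lt_add_one (k : ℝ))
    simpa [energyOn] using this
  refine (add_le_add_right h1 _).trans ?_
  rw [contEnergy, energyOn, ← lintegral_union (MeasurableSet.iUnion fun _ => measurableSet_Ioo)]
  · refine lintegral_mono_set (union_subset (fun x hx => hx.1) (iUnion_subset fun k x hx => ?_))
    exact (zero_lt_one.trans_le (one_le_pnat k)).trans hx.1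
  · refine Set.disjoint_left.2 fun x h2 h3 => ?_
    obtain ⟨k, hk⟩ := mem_iUnion.1 h3
    exact absurd (h2.2.trans_le (one_le_pnat k)) (not_lt.2 hk.1.le)

theorem ranJ_subset_maxDom (a : ℕ+ → ℝ) : ranJ a ⊆ maxDom a := by
  rintro f ⟨u, hu⟩
  exact ⟨u, hu.isACVersion, hu.1.locAC.contEnergy_add_jumpEnergy_le.trans_lt hu.1.energy⟩

theorem graphForm_ranJGraph {a : ℕ+ → ℝ} (ha : ∀ k, 0 < a k) {u : ℝ → ℝ} {f : L2 a}
    (h : IsRestriction a u f) : graphForm (ranJGraph a) f = contEnergy u + jumpEnergy u := by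
  have hlt := memLp_grad_iff.2 (h.1.locAC.contEnergy_add_jumpEnergy_le.trans_lt h.1.energy)
  have hmem : (f, hlt.toLp) ∈ ranJGraph a := ⟨mem_gradGraph_toLp h.isACVersion hlt, u, h⟩
  rw [graphForm_eq ((singleValued_gradGraph ha).mono (ranJGraph_le a)) hmem,
    enorm_sq_of_ae_eq_grad hlt.coeFn_toLp]

/-! ### The forms `𝓔_l` as inner products, and the projections `P_l` -/

/-- `p` represents `u ∈ 𝓓` in a Hilbert space in such a way that `𝓔_l` becomes the inner
product. -/
def IsDomVec (l : ℝ) (u : ℝ → ℝ) (p : WithLp 2 (Lp ℝ 2 m × Lp ℝ 2 m)) : Prop :=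
  p.fst =ᵐ[m] √2⁻¹ • deriv u ∧ p.snd =ᵐ[m] √l • u

theorem InDom.exists_isDomVec {u : ℝ → ℝ} (h : InDom u) (l : ℝ) : ∃ p, IsDomVec l u p :=
  ⟨WithLp.toLp 2 ((h.memLp_deriv.const_smul √2⁻¹).toLp, (h.memLp.const_smul √l).toLp),
    (h.memLp_deriv.const_smul √2⁻¹).coeFn_toLp, (h.memLp.const_smul √l).coeFn_toLp⟩

theorem IsDomVec.add {l : ℝ} {u v : ℝ → ℝ} {p q : WithLp 2 (Lp ℝ 2 m × Lp ℝ 2 m)}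
    (hu : LocAC u) (hv : LocAC v) (hp : IsDomVec l u p) (hq : IsDomVec l v q) :
    IsDomVec l (u + v) (p + q) := by
  constructor
  · filter_upwards [Lp.coeFn_add p.fst q.fst, hp.1, hq.1, hu.deriv_add hv] with x h1 h2 h3 h4
    simp only [WithLp.add_fst, h1, Pi.add_apply, h2, h3, Pi.smul_apply, h4, smul_add]
  · filter_upwards [Lp.coeFn_add p.snd q.snd, hp.2, hq.2] with x h1 h2 h3
    simp only [WithLp.add_snd, h1, Pi.add_apply, h2, h3, Pi.smul_apply, smul_add]

theorem IsDomVec.smul {l : ℝ} {u : ℝ → ℝ} {p : WithLp 2 (Lp ℝ 2 m × Lp ℝ 2 m)}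
    (hp : IsDomVec l u p) (c : ℝ) : IsDomVec l (c • u) (c • p) := by
  constructor
  · filter_upwards [Lp.coeFn_smul c p.fst, hp.1] with x h1 h2
    simp only [WithLp.smul_fst, h1, Pi.smul_apply, h2, deriv_smul_eq, smul_comm c]
  · filter_upwards [Lp.coeFn_smul c p.snd, hp.2] with x h1 h2
    simp only [WithLp.smul_snd, h1, Pi.smul_apply, h2, smul_comm c]

theorem IsDomVec.sub {l : ℝ} {u v : ℝ → ℝ} {p q : WithLp 2 (Lp ℝ 2 m × Lp ℝ 2 m)}
    (hu : LocAC u) (hv : InDom v) (hp : IsDomVec l u p) (hq : IsDomVec l v q) :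
    IsDomVec l (u - v) (p - q) := by
  have h := hp.add hu (hv.smul (-1)).locAC (hq.smul (-1))
  simpa [sub_eq_add_neg] using h

theorem IsDomVec.eq {l : ℝ} {u : ℝ → ℝ} {p q : WithLp 2 (Lp ℝ 2 m × Lp ℝ 2 m)}
    (hp : IsDomVec l u p) (hq : IsDomVec l u q) : p = q := by
  have h1 : p.fst = q.fst := Lp.ext (hp.1.trans hq.1.symm)
  have h2 : p.snd = q.snd := Lp.ext (hp.2.trans hq.2.symm)
  exact (WithLp.ofLp_injective 2) (Prod.ext h1 h2)

theorem integral_m (f : ℝ → ℝ) : ∫ x, f x ∂m = ∫ x in Ioi 0, 2 * x ^ 2 * f x := by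
  rw [m, integral_withDensity_eq_integral_toReal_smul (by fun_prop)
    (Eventually.of_forall fun _ => ENNReal.ofReal_lt_top)]
  refine integral_congr_ae (Eventually.of_forall fun x => ?_)
  simp only [smul_eq_mul]
  rw [ENNReal.toReal_ofReal (by positivity)]

/-- The factor `√2⁻¹`, the root of one half, cancels the `2` in the density of `m`, since the energy
is taken against `x² dx`. -/
theorem IsDomVec.inner_eq {l : ℝ} (hl : 0 ≤ l) {u v : ℝ → ℝ}
    {p q : WithLp 2 (Lp ℝ 2 m × Lp ℝ 2 m)} (hp : IsDomVec l u p) (hq : IsDomVec l v q) :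
    inner ℝ p q = besselForm l u v := by
  have h1 : inner ℝ p q = inner ℝ p.fst q.fst + inner ℝ p.snd q.snd := rfl
  rw [h1, L2.inner_def, L2.inner_def, besselForm]
  congr 1
  · have : ∫ x, inner ℝ (p.fst x) (q.fst x) ∂m = ∫ x, 2⁻¹ * (deriv u x * deriv v x) ∂m := by
      refine integral_congr_ae ?_
      filter_upwards [hp.1, hq.1] with x h1 h2
      simp only [h1, h2, Pi.smul_apply, smul_eq_mul, RCLike.inner_apply, conj_trivial]
      have := Real.mul_self_sqrt (show (0 : ℝ) ≤ 2⁻¹ by positivity)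
      linear_combination (deriv u x * deriv v x) * this
    rw [this, integral_m]
    refine integral_congr_ae (Eventually.of_forall fun x => ?_)
    ring
  · rw [← integral_const_mul]
    refine integral_congr_ae ?_
    filter_upwards [hp.2, hq.2] with x h1 h2
    simp only [h1, h2, Pi.smul_apply, smul_eq_mul, RCLike.inner_apply, conj_trivial]
    linear_combination (u x * v x) * Real.mul_self_sqrt hl

theorem IsDomVec.ofReal_besselForm {l : ℝ} (hl : 0 ≤ l) {u : ℝ → ℝ}
    {p : WithLp 2 (Lp ℝ 2 m × Lp ℝ 2 m)} (hp : IsDomVec l u p) :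
    ENNReal.ofReal (besselForm l u u) =
      energyOn u (Ioi 0) + ENNReal.ofReal l * ∫⁻ x, ‖u x‖ₑ ^ 2 ∂m := by
  have h2 : inner ℝ p p = ‖p.fst‖ ^ 2 + ‖p.snd‖ ^ 2 := by
    rw [← real_inner_self_eq_norm_sq, ← real_inner_self_eq_norm_sq]; rfl
  have h3 : ∀ y : Lp ℝ 2 m, ENNReal.ofReal (‖y‖ ^ 2) = ∫⁻ x, ‖y x‖ₑ ^ 2 ∂m := fun y => by
    rw [← enorm_sq_Lp, ENNReal.ofReal_pow (norm_nonneg _), ofReal_norm]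
  rw [← hp.inner_eq hl hp, h2, ENNReal.ofReal_add (by positivity) (by positivity), h3, h3]
  congr 1
  · have : ∫⁻ x, ‖p.fst x‖ₑ ^ 2 ∂m = ∫⁻ x, 2⁻¹ * ‖deriv u x‖ₑ ^ 2 ∂m := by
      refine lintegral_congr_ae ?_
      filter_upwards [hp.1] with x h1
      rw [h1, enorm_sq_eq_ofReal, enorm_sq_eq_ofReal, Pi.smul_apply, smul_eq_mul, mul_pow,
        Real.sq_sqrt (by positivity), ENNReal.ofReal_mul (by positivity)]
      congr 1
      rw [ENNReal.ofReal_inv_of_pos two_pos]; simp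
    rw [this, lintegral_const_mul' _ _ (by simp), lintegral_deriv_m, ← mul_assoc,
      ENNReal.inv_mul_cancel (by simp) (by simp), one_mul]
  · rw [← lintegral_const_mul' _ _ ENNReal.ofReal_ne_top]
    refine lintegral_congr_ae ?_
    filter_upwards [hp.2] with x h1
    rw [h1, enorm_sq_eq_ofReal, enorm_sq_eq_ofReal, Pi.smul_apply, smul_eq_mul, mul_pow,
      Real.sq_sqrt hl, ENNReal.ofReal_mul hl]

/-- The image of `ker J`. -/
noncomputable def kerJSubmodule (a : ℕ+ → ℝ) (l : ℝ) :
    Submodule ℝ (WithLp 2 (Lp ℝ 2 m × Lp ℝ 2 m)) where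
  carrier := {p | ∃ v ∈ kerJ a, IsDomVec l v p}
  add_mem' := by
    rintro p q ⟨u, hu, hp⟩ ⟨v, hv, hq⟩
    refine ⟨u + v, ⟨hu.1.add hv.1, ?_⟩, hp.add hu.1.locAC hv.1.locAC hq⟩
    simpa using hu.2.add hv.2
  zero_mem' := by
    obtain ⟨p, hp⟩ := InDom.zero.exists_isDomVec l
    refine ⟨0, ⟨InDom.zero, EventuallyEq.rfl⟩, ?_⟩
    simpa using hp.smul 0
  smul_mem' := by
    rintro c p ⟨u, hu, hp⟩
    refine ⟨c • u, ⟨hu.1.smul c, ?_⟩, hp.smul c⟩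
    simpa using hu.2.const_smul c

theorem LocAC.eq_add_integral {u : ℝ → ℝ} (hu : LocAC u) {b x : ℝ} (hb : 0 < b) (hx : 0 < x) :
    u x = u b + ∫ t in b..x, deriv u t := by
  have h : AbsolutelyContinuousOnInterval u b x := by
    rcases le_total b x with h | h
    · exact hu b x hb h
    · exact (hu x b hx h).symm
  rw [h.integral_deriv_eq_sub]; ring

theorem intervalIntegral_congr_m {f g : ℝ → ℝ} (h : f =ᵐ[m] g) {b c : ℝ} (hb : 0 < b)
    (hc : 0 < c) : ∫ t in b..c, f t = ∫ t in b..c, g t := by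
  refine intervalIntegral.integral_congr_ae ?_
  filter_upwards [ae_m_iff.1 h] with t ht htx
  exact ht ((lt_min hb hc).trans htx.1)

/-- Elements of `ker J` vanish at the atom `1`, so each is the integral of its derivative from `1`;
convergence of derivatives in `L²(m)` then gives pointwise convergence, which preserves vanishing
`μ`-a.e. The assumption `l > 0` recovers square integrability of the limit. Closedness is what makes
the projections `P_l` exist. -/
theorem isClosed_kerJSubmodule {a : ℕ+ → ℝ} (ha : ∀ k, 0 < a k) {l : ℝ} (hl : 0 < l) :
    IsClosed (kerJSubmodule a l : Set (WithLp 2 (Lp ℝ 2 m × Lp ℝ 2 m))) := by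
  refine IsSeqClosed.isClosed fun p q hp hq => ?_
  choose v hv hd using hp
  have h1 : Tendsto (fun n => (p n).fst) atTop (𝓝 q.fst) :=
    ((WithLp.continuous_fst 2 _ _).tendsto _).comp hq
  have h2 : Tendsto (fun n => (p n).snd) atTop (𝓝 q.snd) :=
    ((WithLp.continuous_snd 2 _ _).tendsto _).comp hq
  obtain ⟨ns, hns, h3⟩ := exists_subseq_ae_tendsto h2
  set s : ℝ := √2⁻¹
  have hs : s ≠ 0 := by simp [s]
  have hg : MemLp (s⁻¹ • q.fst : ℝ → ℝ) 2 m := (Lp.memLp q.fst).const_smul _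
  have hgi : ∀ b c : ℝ, 0 < b → b ≤ c →
      IntervalIntegrable (s⁻¹ • q.fst : ℝ → ℝ) volume b c :=
    fun b c hb hbc => intervalIntegrable_of_memLp_m hg hb hbc
  have hφ := locAC_integral hgi 0 one_pos
  have hφd := ae_hasDerivAt_integral hgi 0 one_pos
  set φ : ℝ → ℝ := fun x => 0 + ∫ t in (1 : ℝ)..x, (s⁻¹ • q.fst : ℝ → ℝ) t with hφ_def
  have hv1 : ∀ n, v n 1 = 0 := fun n => by simpa using ((ae_mu_iff ha).1 (hv n).2).2 1
  have hlim : ∀ x, 0 < x → Tendsto (fun n => v n x) atTop (𝓝 (φ x)) := by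
    intro x hx
    have h := (tendsto_intervalIntegral_m h1 one_pos hx).const_mul s⁻¹
    simp only [hφ_def, zero_add, Pi.smul_apply, smul_eq_mul, intervalIntegral.integral_const_mul]
    refine h.congr fun n => ?_
    rw [(hv n).1.locAC.eq_add_integral one_pos hx, hv1 n, zero_add,
      intervalIntegral_congr_m (hd n).1 one_pos hx]
    simp only [Pi.smul_apply, smul_eq_mul, intervalIntegral.integral_const_mul]
    rw [← mul_assoc, inv_mul_cancel₀ hs, one_mul]
  have hderiv : deriv φ =ᵐ[m] s⁻¹ • q.fst := by
    refine ae_m_iff.2 (hφd.mono fun x hx h0 => (hx h0).deriv)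
  have hsnd : q.snd =ᵐ[m] √l • φ := by
    have hall : ∀ᵐ x ∂m, ∀ i, (p (ns i)).snd x = (√l • v (ns i)) x :=
      ae_all_iff.2 fun i => (hd (ns i)).2
    have hpos : ∀ᵐ x ∂m, 0 < x := ae_m_iff.2 (Eventually.of_forall fun x hx => hx)
    filter_upwards [h3, hall, hpos] with x hx hx2 h0
    refine tendsto_nhds_unique hx ?_
    refine (((hlim x h0).comp hns.tendsto_atTop).const_mul √l).congr fun i => ?_
    rw [hx2 i]; rfl
  have hsl : √l ≠ 0 := (Real.sqrt_pos.2 hl).ne'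
  have hmem : MemLp φ 2 m := by
    have : φ = (√l)⁻¹ • (√l • φ) := by rw [smul_smul, inv_mul_cancel₀ hsl, one_smul]
    rw [this]
    exact ((memLp_congr_ae hsnd).1 (Lp.memLp q.snd)).const_smul _
  refine ⟨φ, ⟨inDom_iff.2 ⟨hφ, (memLp_congr_ae hderiv).2 hg, hmem⟩, ?_⟩, ?_, hsnd⟩
  · have hall := fun n => (ae_mu_iff ha).1 (hv n).2
    refine (ae_mu_iff ha).2 ⟨?_, fun k => ?_⟩
    · filter_upwards [ae_all_iff.2 fun n => (hall n).1] with x hx h0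
      refine tendsto_nhds_unique (hlim x h0.1) (tendsto_const_nhds.congr fun n => (hx n h0).symm)
    · refine tendsto_nhds_unique (hlim k (zero_lt_one.trans_le (one_le_pnat k)))
        (tendsto_const_nhds.congr fun n => ((hall n).2 k).symm)
  · filter_upwards [hderiv] with x hx
    rw [Pi.smul_apply, hx, Pi.smul_apply, smul_smul, mul_inv_cancel₀ hs, one_smul]

theorem besselForm_comm (l : ℝ) (u v : ℝ → ℝ) : besselForm l u v = besselForm l v u := by
  simp only [besselForm, mul_comm]

/-- Every `u ∈ 𝓓` decomposes along `ker J` and its `𝓔_l`-orthogonal complement. -/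
theorem InDom.exists_kerJ_sub_mem_kerJPerp {a : ℕ+ → ℝ} (ha : ∀ k, 0 < a k) {l : ℝ} (hl : 0 < l)
    {u : ℝ → ℝ} (hu : InDom u) : ∃ v ∈ kerJ a, u - v ∈ kerJPerp a l := by
  have : CompleteSpace (kerJSubmodule a l) := (isClosed_kerJSubmodule ha hl).completeSpace_coe
  obtain ⟨p, hp⟩ := hu.exists_isDomVec l
  obtain ⟨y, ⟨v, hv, hy⟩, z, hz, rfl⟩ := (kerJSubmodule a l).exists_add_mem_mem_orthogonal p
  refine ⟨v, hv, hu.sub hv.1, fun w hw => ?_⟩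
  obtain ⟨q, hq⟩ := hw.1.exists_isDomVec l
  have h := hp.sub hu.locAC hv.1 hy
  rw [add_sub_cancel_left] at h
  rw [← h.inner_eq hl.le hq, real_inner_comm]
  exact hz q ⟨w, hw, hq⟩

theorem isProjection_sub {a : ℕ+ → ℝ} {l : ℝ} {u v : ℝ → ℝ} (hv : v ∈ kerJ a)
    (h : u - v ∈ kerJPerp a l) : IsProjection a l u (u - v) := by
  refine ⟨h, fun w hw => ?_⟩
  rw [sub_sub_cancel, besselForm_comm]
  exact hw.2 v hv

/-- The difference of two projections of `u` lies in the complement of `ker J` and is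
`𝓔_l`-orthogonal to it, hence to itself. As functions on `ℝ` the two may still differ off `(0, ∞)`,
so uniqueness is stated for the energy. -/
theorem IsProjection.besselForm_eq {a : ℕ+ → ℝ} {l : ℝ} (hl : 0 ≤ l) {u w w' : ℝ → ℝ}
    (hu : InDom u) (h : IsProjection a l u w) (h' : IsProjection a l u w') :
    besselForm l w w = besselForm l w' w' := by
  obtain ⟨p, hp⟩ := hu.exists_isDomVec l
  obtain ⟨q, hq⟩ := h.1.1.exists_isDomVec l
  obtain ⟨q', hq'⟩ := h'.1.1.exists_isDomVec l
  have hd := hq.sub h.1.1.locAC h'.1.1 hq'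
  have hperp : w - w' ∈ kerJPerp a l := by
    refine ⟨h.1.1.sub h'.1.1, fun v hv => ?_⟩
    obtain ⟨r, hr⟩ := hv.1.exists_isDomVec l
    rw [← hd.inner_eq hl hr, inner_sub_left, hq.inner_eq hl hr, hq'.inner_eq hl hr,
      h.1.2 v hv, h'.1.2 v hv, sub_zero]
  have h1 := h.2 _ hperp
  have h2 := h'.2 _ hperp
  rw [← (hp.sub hu.locAC h.1.1 hq).inner_eq hl hd] at h1
  rw [← (hp.sub hu.locAC h'.1.1 hq').inner_eq hl hd] at h2
  have h3 : inner ℝ (q - q') (q - q') = 0 := by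
    have e : q - q' = (p - q') - (p - q) := by abel
    nth_rewrite 1 [e]
    rw [inner_sub_left, h1, h2, sub_zero]
  rw [inner_self_eq_zero, sub_eq_zero] at h3
  rw [← hq.inner_eq hl hq, ← hq'.inner_eq hl hq', h3]

/-- The projection differs from `u` by an element of `ker J`, so it is another extension of `f` and
obeys the lower bound for extensions. -/
theorem graphForm_le_traceApprox {a : ℕ+ → ℝ} (ha : ∀ k, 0 < a k) {l : ℝ} (hl : 0 < l)
    (f : L2 a) : graphForm (ranJGraph a) f ≤ traceApprox a l f := by
  refine le_iInf fun u => le_iInf fun w => le_iInf fun hr => le_iInf fun hp => ?_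
  obtain ⟨v, hv, hperp⟩ := hr.1.exists_kerJ_sub_mem_kerJPerp ha hl
  rw [hp.besselForm_eq hl.le hr.1 (isProjection_sub hv hperp)]
  have hr' : IsRestriction a (u - v) f :=
    ⟨hr.1.sub hv.1, hr.2.trans (by simpa using (EventuallyEq.refl _ u).sub hv.2.symm)⟩
  obtain ⟨p, hp⟩ := hr'.1.exists_isDomVec l
  rw [graphForm_ranJGraph ha hr', hp.ofReal_besselForm hl.le]
  exact (hr'.1.locAC.contEnergy_add_jumpEnergy_le).trans le_self_add

/-- By Pythagoras the projection does not increase `𝓔_l`, so any extension of `f` serves as a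
competitor. -/
theorem IsRestriction.traceApprox_le {a : ℕ+ → ℝ} (ha : ∀ k, 0 < a k) {l : ℝ} (hl : 0 < l)
    {f : L2 a} {u : ℝ → ℝ} (hr : IsRestriction a u f) :
    traceApprox a l f ≤ energyOn u (Ioi 0) + ENNReal.ofReal l * ∫⁻ x, ‖u x‖ₑ ^ 2 ∂m := by
  obtain ⟨v, hv, hperp⟩ := hr.1.exists_kerJ_sub_mem_kerJPerp ha hl
  obtain ⟨p, hp⟩ := hr.1.exists_isDomVec l
  obtain ⟨q, hq⟩ := hv.1.exists_isDomVec l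
  have hd := hp.sub hr.1.locAC hv.1 hq
  rw [← hp.ofReal_besselForm hl.le]
  refine (iInf_le_of_le u <| iInf_le_of_le (u - v) <| iInf_le_of_le hr <|
    iInf_le_of_le (isProjection_sub hv hperp) (ENNReal.ofReal_le_ofReal ?_))
  have h0 : inner ℝ (p - q) q = 0 := (hd.inner_eq hl.le hq).trans (hperp.2 v hv)
  rw [← hd.inner_eq hl.le hd, ← hp.inner_eq hl.le hp]
  have h1 : inner ℝ p p = inner ℝ ((p - q) + q) ((p - q) + q) := by rw [sub_add_cancel]
  rw [h1, real_inner_add_add_self, h0]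
  have : 0 ≤ inner ℝ q q := real_inner_self_nonneg
  linarith

/-! ### Harmonic interpolation -/

/-- Replacing `u` by the harmonic function with the same boundary values on `(b, c)`. -/
theorem LocAC.exists_harmonic {u : ℝ → ℝ} (hu : LocAC u) {b c : ℝ} (hb : 0 < b) (hbc : b < c) :
    ∃ v, LocAC v ∧ (∀ x, 0 < x → x ∉ Ioo b c → v x = u x) ∧
      (∃ M, ∀ x, 0 < x → |v x - u x| ≤ M) ∧
      energyOn v (Ioc b c) = ENNReal.ofReal (b * c / (c - b) * (u c - u b) ^ 2) := by
  have hc := hb.trans hbc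
  set C : ℝ := b * c / (c - b) * (u c - u b) with hC
  have hui : ∀ p q : ℝ, 0 < p → p ≤ q → IntervalIntegrable (deriv u) volume p q :=
    fun p q hp hpq => (hu p q hp hpq).intervalIntegrable_deriv
  -- The correction has as derivative the harmonic derivative minus `u'`, cut off to `(b, c]`. The
  -- choice of `C` gives it mean zero, so its primitive vanishes outside `(b, c)`.
  set h : ℝ → ℝ := fun t => C * (t ^ 2)⁻¹ - deriv u t
  have hhi : ∀ p q : ℝ, 0 < p → p ≤ q → IntervalIntegrable h volume p q := fun p q hp hpq =>
    ((intervalIntegrable_inv_sq hp (hp.trans_le hpq)).const_mul C).sub (hui p q hp hpq)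
  set g : ℝ → ℝ := (Ioc b c).indicator h
  have hgi : ∀ p q : ℝ, 0 < p → p ≤ q → IntervalIntegrable g volume p q := by
    intro p q hp hpq
    rw [intervalIntegrable_iff_integrableOn_Ioc_of_le hpq]
    exact ((intervalIntegrable_iff_integrableOn_Ioc_of_le hpq).1 (hhi p q hp hpq)).indicator
      measurableSet_Ioc
  have hac := locAC_integral hgi 0 hb
  have hder := ae_hasDerivAt_integral hgi 0 hb
  set w : ℝ → ℝ := fun x => 0 + ∫ t in b..x, g t with hw
  have hw1 : ∀ x, 0 < x → x ≤ b → w x = 0 := by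
    intro x hx hxb
    rw [hw]
    simp only [zero_add]
    rw [intervalIntegral.integral_symm, intervalIntegral.integral_of_le hxb,
      setIntegral_eq_zero_of_forall_eq_zero, neg_zero]
    exact fun t ht => indicator_of_notMem (fun h => absurd ht.2 (not_le.2 h.1)) _
  have hwc : w c = 0 := by
    rw [hw]
    simp only [zero_add]
    rw [intervalIntegral.integral_of_le hbc.le, setIntegral_indicator measurableSet_Ioc,
      inter_self, ← intervalIntegral.integral_of_le hbc.le,
      intervalIntegral.integral_sub ((intervalIntegrable_inv_sq hb hc).const_mul C)
        (hui b c hb hbc.le), intervalIntegral.integral_const_mul, integral_inv_sq hb hc,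
      (hu b c hb hbc.le).integral_deriv_eq_sub, hC]
    have : c - b ≠ 0 := (sub_pos.2 hbc).ne'
    field_simp
    ring
  have hw2 : ∀ x, c ≤ x → w x = 0 := by
    intro x hx
    have e : w x = w c + ∫ t in c..x, g t := by
      simp only [hw, zero_add]
      exact (intervalIntegral.integral_add_adjacent_intervals (hgi b c hb hbc.le)
        (hgi c x hc hx)).symm
    rw [e, hwc, zero_add, intervalIntegral.integral_of_le hx]
    exact setIntegral_eq_zero_of_forall_eq_zero fun t ht =>
      indicator_of_notMem (fun h => absurd ht.1 (not_lt.2 h.2)) _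
  have hw0 : ∀ x, 0 < x → x ∉ Ioo b c → w x = 0 := by
    intro x hx hxn
    rcases le_or_gt x b with h1 | h1
    · exact hw1 x hx h1
    · exact hw2 x (not_lt.1 fun h2 => hxn ⟨h1, h2⟩)
  refine ⟨u + w, fun p q hp hpq => (hu p q hp hpq).add (hac p q hp hpq), fun x hx hxn => ?_,
    ?_, ?_⟩
  · rw [Pi.add_apply, hw0 x hx hxn, add_zero]
  · obtain ⟨M, hM⟩ := (hac b c hb hbc.le).exists_bound
    refine ⟨max M 0, fun x hx => ?_⟩
    rw [Pi.add_apply, add_sub_cancel_left]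
    by_cases hx' : x ∈ Ioo b c
    · refine le_max_of_le_left (hM x ?_)
      rw [uIcc_of_le hbc.le]
      exact ⟨hx'.1.le, hx'.2.le⟩
    · rw [hw0 x hx hx', abs_zero]
      exact le_max_right _ _
  · have e : energyOn (u + w) (Ioc b c) =
        ∫⁻ t in Ioc b c, ENNReal.ofReal (C ^ 2 * (t ^ 2)⁻¹) := by
      refine setLIntegral_congr_fun_ae measurableSet_Ioc ?_
      filter_upwards [hu.ae_differentiableAt, hder] with t h1 h2 ht
      have h0 : 0 < t := hb.trans ht.1
      rw [_root_.deriv_add (h1 h0) (h2 h0).differentiableAt, (h2 h0).deriv]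
      simp only [g, indicator_of_mem ht, h]
      congr 1
      field_simp
      ring
    have hi := (intervalIntegrable_iff_integrableOn_Ioc_of_le hbc.le).1
      ((intervalIntegrable_inv_sq hb hc).const_mul (C ^ 2))
    rw [e, ← ofReal_integral_eq_lintegral_ofReal hi
      (Eventually.of_forall fun t => by positivity), ← intervalIntegral.integral_of_le hbc.le,
      intervalIntegral.integral_const_mul, integral_inv_sq hb hc, hC]
    congr 1
    have : c - b ≠ 0 := (sub_pos.2 hbc).ne'
    field_simp

theorem energyOn_congr {u v : ℝ → ℝ} {s : Set ℝ} (hs : IsOpen s) (h : EqOn u v s) :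
    energyOn u s = energyOn v s := by
  refine setLIntegral_congr_fun hs.measurableSet fun x hx => ?_
  have : deriv u x = deriv v x := (h.eventuallyEq_of_mem (hs.mem_nhds hx)).deriv_eq
  simp only [this]

theorem energyOn_union {u : ℝ → ℝ} {s t : Set ℝ} (ht : MeasurableSet t) (h : Disjoint s t) :
    energyOn u (s ∪ t) = energyOn u s + energyOn u t := lintegral_union ht h

theorem energyOn_Ioc {u : ℝ → ℝ} (b c : ℝ) : energyOn u (Ioc b c) = energyOn u (Ioo b c) := by
  rw [energyOn, energyOn, restrict_Ioo_eq_restrict_Ioc]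

theorem memLp_m_of_bounded_of_support {w : ℝ → ℝ} {b c M : ℝ}
    (hw : AEStronglyMeasurable w m) (hM : ∀ x, 0 < x → |w x| ≤ M)
    (h0 : ∀ x, 0 < x → x ∉ Ioo b c → w x = 0) : MemLp w 2 m := by
  rw [memLp_two_iff hw, lintegral_m]
  calc ∫⁻ x in Ioi 0, ENNReal.ofReal (2 * x ^ 2) * ‖w x‖ₑ ^ 2
      ≤ ∫⁻ x in Ioi 0, (Ioo b c).indicator
          (fun _ => ENNReal.ofReal (2 * (|b| + |c|) ^ 2) * ENNReal.ofReal (M ^ 2)) x := by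
        refine setLIntegral_mono' measurableSet_Ioi fun x hx => ?_
        by_cases hx' : x ∈ Ioo b c
        · rw [indicator_of_mem hx', enorm_sq_eq_ofReal]
          have h1 : x ≤ |b| + |c| := by
            have := le_abs_self c
            have := abs_nonneg b
            linarith [hx'.2]
          have h2 : (0 : ℝ) ≤ x := le_of_lt hx
          exact mul_le_mul' (ENNReal.ofReal_le_ofReal (by gcongr))
            (ENNReal.ofReal_le_ofReal (sq_le_sq.2 ((hM x hx).trans (le_abs_self M))))
        · simp [h0 x hx hx']
    _ ≤ ∫⁻ x, (Ioo b c).indicator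
          (fun _ => ENNReal.ofReal (2 * (|b| + |c|) ^ 2) * ENNReal.ofReal (M ^ 2)) x :=
        setLIntegral_le_lintegral _ _
    _ < ⊤ := by
        rw [lintegral_indicator measurableSet_Ioo, setLIntegral_const]
        exact ENNReal.mul_lt_top (ENNReal.mul_lt_top ENNReal.ofReal_lt_top ENNReal.ofReal_lt_top)
          (by simp)

theorem LocAC.aestronglyMeasurable {u : ℝ → ℝ} (hu : LocAC u) : AEStronglyMeasurable u m := by
  refine aestronglyMeasurable_m (ContinuousOn.aestronglyMeasurable ?_ measurableSet_Ioi)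
  intro x hx
  have hx' : (0 : ℝ) < x := hx
  have h := (hu (x / 2) (2 * x) (by linarith) (by linarith)).continuousOn
  rw [uIcc_of_le (by linarith)] at h
  exact (h.continuousAt (Icc_mem_nhds (by linarith) (by linarith))).continuousWithinAt

/-- Harmonic interpolation on the intervals `(1, 2), …, (n, n + 1)`. -/
theorem InDom.exists_interpolation {u : ℝ → ℝ} (hu : InDom u) (n : ℕ) :
    ∃ v, InDom v ∧ (∀ x, 0 < x → x ≤ 1 → v x = u x) ∧ (∀ k : ℕ+, v k = u k) ∧
      (∀ x, (n : ℝ) + 1 ≤ x → v x = u x) ∧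
      energyOn v (Ioc 0 (n + 1)) ≤ contEnergy u + jumpEnergy u := by
  -- The induction carries the exact energy; the index `k` stands for the interval `(k + 1, k + 2)`.
  -- Finiteness of the total energy follows afterwards, since `v` agrees with `u` beyond `n + 1`.
  suffices H : ∃ v, LocAC v ∧ MemLp v 2 m ∧ (∀ x, 0 < x → x ≤ 1 → v x = u x) ∧
      (∀ k : ℕ+, v k = u k) ∧ (∀ x, (n : ℝ) + 1 ≤ x → v x = u x) ∧
      energyOn v (Ioc 0 (n + 1)) = contEnergy u + ∑ k ∈ Finset.range n,
        ENNReal.ofReal (((k : ℝ) + 1) * ((k : ℝ) + 1 + 1) *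
          (u ((k : ℝ) + 1 + 1) - u ((k : ℝ) + 1)) ^ 2) by
    obtain ⟨v, h1, h2, h3, h4, h5, h6⟩ := H
    have h7 : energyOn v (Ioc 0 (n + 1)) ≤ contEnergy u + jumpEnergy u := by
      rw [h6, jumpEnergy, tsum_pnat_eq_tsum_succ (f := fun k : ℕ =>
        ENNReal.ofReal ((k : ℝ) * ((k : ℝ) + 1) * (u ((k : ℝ) + 1) - u (k : ℝ)) ^ 2))]
      push_cast
      gcongr
      exact ENNReal.sum_le_tsum _
    refine ⟨v, ⟨h1, ?_, h2⟩, h3, h4, h5, h7⟩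
    change energyOn v (Ioi 0) < ⊤
    rw [← Ioc_union_Ioi_eq_Ioi (show (0 : ℝ) ≤ n + 1 by positivity), energyOn_union measurableSet_Ioi
      (Set.disjoint_left.2 fun x hx hx' => absurd hx.2 (not_le.2 hx')),
      energyOn_congr isOpen_Ioi fun x hx => h5 x (le_of_lt hx)]
    refine ENNReal.add_lt_top.2 ⟨h7.trans_lt ?_, ?_⟩
    · exact hu.locAC.contEnergy_add_jumpEnergy_le.trans_lt hu.energy
    · refine lt_of_le_of_lt (lintegral_mono_set fun x hx => ?_) hu.energy
      have h0 : (0 : ℝ) ≤ n + 1 := by positivity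
      exact lt_of_le_of_lt h0 hx
  induction n with
  | zero =>
    refine ⟨u, hu.locAC, hu.memLp, fun _ _ _ => rfl, fun _ => rfl, fun _ _ => rfl, ?_⟩
    simp only [Nat.cast_zero, zero_add, Finset.range_zero, Finset.sum_empty, add_zero]
    exact energyOn_Ioc 0 1
  | succ n ih =>
    obtain ⟨v, h1, h2, h3, h4, h5, h6⟩ := ih
    have hn : (0 : ℝ) < (n : ℝ) + 1 := by positivity
    have hn1 : (1 : ℝ) ≤ (n : ℝ) + 1 := by simp
    obtain ⟨w, hw, hwv, ⟨M, hM⟩, hE⟩ := h1.exists_harmonic hn (lt_add_one ((n : ℝ) + 1))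
    have hwv' : ∀ x, 0 < x → x ≤ (n : ℝ) + 1 → w x = v x := fun x hx hxn =>
      hwv x hx fun h => absurd h.1 (not_lt.2 hxn)
    have hwv2 : ∀ x, (n : ℝ) + 1 + 1 ≤ x → w x = u x := fun x hx => by
      rw [hwv x (by linarith) fun h => absurd h.2 (not_lt.2 hx), h5 x (by linarith)]
    push_cast
    refine ⟨w, hw, ?_, fun x hx hx1 => ?_, fun k => ?_, hwv2, ?_⟩
    · have h := memLp_m_of_bounded_of_support (w := w - v) (hw.aestronglyMeasurable.sub
        h1.aestronglyMeasurable) hM fun x hx hxn => by rw [Pi.sub_apply, hwv x hx hxn, sub_self]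
      simpa using h.add h2
    · rw [hwv' x hx (hx1.trans hn1), h3 x hx hx1]
    · rw [← h4 k]
      refine hwv k (zero_lt_one.trans_le (one_le_pnat k)) fun h => ?_
      have e1 : n + 1 < (k : ℕ) := by exact_mod_cast h.1
      have e2 : (k : ℕ) < n + 1 + 1 := by exact_mod_cast h.2
      omega
    · rw [← Ioc_union_Ioc_eq_Ioc hn.le (lt_add_one ((n : ℝ) + 1)).le,
        energyOn_union measurableSet_Ioc
          (Set.disjoint_left.2 fun x hx hx' => absurd hx.2 (not_le.2 hx'.1)), hE, energyOn_Ioc,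
        energyOn_congr isOpen_Ioo fun x hx => hwv' x hx.1 hx.2.le, ← energyOn_Ioc, h6,
        Finset.sum_range_succ, add_assoc, h5 _ le_rfl, h5 _ (le_of_lt (lt_add_one _)),
        add_sub_cancel_left, div_one]

theorem tendsto_energyOn_Ioi {u : ℝ → ℝ} (hu : energyOn u (Ioi 0) < ⊤) :
    Tendsto (fun n : ℕ => energyOn u (Ioi ((n : ℝ) + 1))) atTop (𝓝 0) := by
  have hmeas : Measurable fun x => ENNReal.ofReal (deriv u x ^ 2 * x ^ 2) := by fun_prop
  set κ := (volume.restrict (Ioi 0)).withDensity fun x => ENNReal.ofReal (deriv u x ^ 2 * x ^ 2)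
  have : IsFiniteMeasure κ := isFiniteMeasure_withDensity hu.ne
  have h1 : ∀ n : ℕ, energyOn u (Ioi ((n : ℝ) + 1)) = κ (Ioi ((n : ℝ) + 1)) := by
    intro n
    have h0 : (0 : ℝ) ≤ n + 1 := by positivity
    rw [withDensity_apply _ measurableSet_Ioi, Measure.restrict_restrict measurableSet_Ioi,
      inter_eq_left.2 (Ioi_subset_Ioi h0), energyOn]
  simp only [h1]
  have h2 := tendsto_measure_iInter_atTop (μ := κ) (s := fun n : ℕ => Ioi ((n : ℝ) + 1))
    (fun n => measurableSet_Ioi.nullMeasurableSet)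
    (fun i j hij => Ioi_subset_Ioi (by gcongr)) ⟨0, measure_ne_top _ _⟩
  have h3 : ⋂ n : ℕ, Ioi ((n : ℝ) + 1) = ∅ := by
    refine eq_empty_of_forall_notMem fun x hx => ?_
    obtain ⟨n, hn⟩ := exists_nat_gt x
    have := mem_iInter.1 hx n
    simp only [mem_Ioi] at this
    linarith
  rwa [h3, measure_empty] at h2

/-- As `l ↓ 0`, the forms `Ju ↦ 𝓔_l[P_l u]` decrease to `𝓠` on `ran J`. -/
theorem eventually_traceApprox_le {a : ℕ+ → ℝ} (ha : ∀ k, 0 < a k) (f : L2 a) (c : ℝ≥0∞)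
    (hc : graphForm (ranJGraph a) f < c) (l : ℕ → ℝ) (hl : ∀ n, 0 < l n)
    (hl0 : Tendsto l atTop (𝓝 0)) : ∀ᶠ n in atTop, traceApprox a (l n) f ≤ c := by
  obtain ⟨y, hy⟩ := graphForm_lt_top_iff.1 (hc.trans_le le_top)
  obtain ⟨u, hu⟩ : f ∈ ranJ a := hy.2
  rw [graphForm_ranJGraph ha hu] at hc
  have h1 : Tendsto (fun n : ℕ => contEnergy u + jumpEnergy u + energyOn u (Ioi ((n : ℝ) + 1))) atTop
      (𝓝 (contEnergy u + jumpEnergy u + 0)) :=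
    tendsto_const_nhds.add (tendsto_energyOn_Ioi hu.1.energy)
  rw [add_zero] at h1
  -- First `n` is fixed so that the tail energy fits below `c`. The interpolant is then independent
  -- of `l`, and its `L²` term tends to zero.
  obtain ⟨n, hn⟩ := (h1.eventually_lt_const hc).exists
  obtain ⟨v, hv, hv1, hvk, hvn, hvE⟩ := hu.1.exists_interpolation n
  have hr : IsRestriction a v f := by
    refine ⟨hv, (ae_mu_iff ha).2 ⟨?_, fun k => ?_⟩⟩
    · filter_upwards [((ae_mu_iff ha).1 hu.2).1] with x hx h0
      rw [hx h0, hv1 x h0.1 h0.2.le]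
    · rw [((ae_mu_iff ha).1 hu.2).2 k, hvk]
  have hE : energyOn v (Ioi 0) < c := by
    refine lt_of_le_of_lt ?_ hn
    rw [← Ioc_union_Ioi_eq_Ioi (show (0 : ℝ) ≤ n + 1 by positivity), energyOn_union measurableSet_Ioi
      (Set.disjoint_left.2 fun x hx hx' => absurd hx.2 (not_le.2 hx')),
      energyOn_congr (u := v) (v := u) isOpen_Ioi fun x hx => hvn x (le_of_lt hx)]
    gcongr
  have hfin : ∫⁻ x, ‖v x‖ₑ ^ 2 ∂m < ⊤ := (memLp_two_iff hv.memLp.1).1 hv.memLp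
  have h2 : Tendsto (fun j => energyOn v (Ioi 0) + ENNReal.ofReal (l j) * ∫⁻ x, ‖v x‖ₑ ^ 2 ∂m) atTop
      (𝓝 (energyOn v (Ioi 0) + ENNReal.ofReal 0 * ∫⁻ x, ‖v x‖ₑ ^ 2 ∂m)) :=
    tendsto_const_nhds.add (ENNReal.Tendsto.mul_const (ENNReal.tendsto_ofReal hl0)
      (Or.inr hfin.ne))
  simp only [ENNReal.ofReal_zero, zero_mul, add_zero] at h2
  filter_upwards [h2.eventually_lt_const hE] with j hj
  exact (hr.traceApprox_le ha (hl j)).trans hj.le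

theorem isTraceForm_closure {a : ℕ+ → ℝ} (ha : ∀ k, 0 < a k) :
    IsTraceForm a (graphForm (ranJGraph a).topologicalClosure) :=
  isMoscoLimitAtZero_graphForm (singleValued_closure_ranJGraph ha)
    (fun _ hl f => graphForm_le_traceApprox ha hl f) (eventually_traceApprox_le ha)

/-! ### Density of `ran J` -/

theorem intervalIntegrable_indicator {g : ℝ → ℝ} {b c : ℝ} (hbc : b ≤ c) {s : Set ℝ}
    (hs : MeasurableSet s) (h : IntegrableOn g (Ioc b c ∩ s)) :
    IntervalIntegrable (s.indicator g) volume b c := by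
  rw [intervalIntegrable_iff_integrableOn_Ioc_of_le hbc, IntegrableOn,
    integrable_indicator_iff hs, IntegrableOn, Measure.restrict_restrict hs, inter_comm]
  exact h

/-- Functions in the maximal domain which vanish at all large integers are in `ran J`. -/
theorem mem_ranJ_of_eventually_zero {a : ℕ+ → ℝ} (ha : ∀ k, 0 < a k) {f : L2 a} {v : ℝ → ℝ}
    (hv : IsACVersion a f v) (hE : contEnergy v < ⊤) {N : ℕ}
    (hN : ∀ k : ℕ+, N ≤ k → v k = 0) : f ∈ ranJ a := by
  -- The slope of the linear interpolant on `(n - 1, n]`, selected below by the ceiling function;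
  -- the values `d 0` and `d 1` are removed by the cutoff at `1`.
  set d : ℕ → ℝ := fun n => v n - v ((n : ℝ) - 1)
  -- The shift by two keeps `n - 1` a positive integer even for `N = 0`.
  have hd : ∀ n, N + 2 ≤ n → d n = 0 := by
    intro n hn
    have h1 := hN ⟨n, by omega⟩ (by simp; omega)
    have h2 := hN ⟨n - 1, by omega⟩ (by simp; omega)
    simp only [PNat.mk_coe] at h1 h2
    rw [Nat.cast_sub (by omega), Nat.cast_one] at h2
    simp only [d, h1, h2, sub_zero]
  set M : ℝ := ∑ n ∈ Finset.range (N + 2), |d n|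
  have hdM : ∀ n, |d n| ≤ M := by
    intro n
    by_cases hn : n < N + 2
    · exact Finset.single_le_sum (f := fun n => |d n|) (fun _ _ => abs_nonneg _)
        (Finset.mem_range.2 hn)
    · rw [hd n (not_lt.1 hn), abs_zero]
      exact Finset.sum_nonneg fun _ _ => abs_nonneg _
  set D : ℝ → ℝ := fun t => d ⌈t⌉₊
  have hDm : Measurable D := (measurable_from_nat (f := d)).comp Nat.measurable_ceil
  set g1 : ℝ → ℝ := (Iic (1 : ℝ)).indicator (deriv v)
  set g2 : ℝ → ℝ := (Ioi (1 : ℝ)).indicator D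
  have hg2m : Measurable g2 := hDm.indicator measurableSet_Ioi
  have hg1i : ∀ b c : ℝ, 0 < b → b ≤ c → IntervalIntegrable g1 volume b c := by
    intro b c hb hbc
    refine intervalIntegrable_indicator hbc measurableSet_Iic ?_
    rcases le_or_gt b 1 with h | h
    · refine IntegrableOn.mono_set ((intervalIntegrable_iff_integrableOn_Ioc_of_le h).1
        (hv.2 b hb h).intervalIntegrable_deriv) fun x hx => ⟨hx.1.1, hx.2⟩
    · have : Ioc b c ∩ Iic 1 = ∅ := eq_empty_of_forall_notMem fun x hx =>
        absurd (h.trans hx.1.1) (not_lt.2 hx.2)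
      rw [this]; exact integrableOn_empty
  have hg2M : ∀ x, |g2 x| ≤ M := by
    intro x
    by_cases hx : x ∈ Ioi (1 : ℝ)
    · rw [show g2 x = D x from indicator_of_mem hx _]
      exact hdM _
    · rw [show g2 x = 0 from indicator_of_notMem hx _, abs_zero]
      exact (abs_nonneg _).trans (hdM 0)
  have hg2i : ∀ b c : ℝ, IntervalIntegrable g2 volume b c := fun b c =>
    (intervalIntegrable_const (c := M)).mono_fun hg2m.aestronglyMeasurable
      (Eventually.of_forall fun x => by
        exact (hg2M x).trans (le_abs_self M))
  -- The derivative of the extension: `v'` up to `1`, then piecewise constant slopes, which vanish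
  -- beyond `N + 1`.
  set g : ℝ → ℝ := fun t => g1 t + g2 t
  have hgi : ∀ b c : ℝ, 0 < b → b ≤ c → IntervalIntegrable g volume b c := fun b c hb hbc =>
    (hg1i b c hb hbc).add (hg2i b c)
  have hac := locAC_integral hgi (v 1) one_pos
  have hder := ae_hasDerivAt_integral hgi (v 1) one_pos
  set u : ℝ → ℝ := fun x => v 1 + ∫ t in (1 : ℝ)..x, g t with hu_def
  have hadd : ∀ b c, 1 ≤ b → b ≤ c → u c = u b + ∫ t in b..c, g t := by
    intro b c hb hbc
    simp only [hu_def]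
    rw [add_assoc, intervalIntegral.integral_add_adjacent_intervals (hgi 1 b one_pos hb)
      (hgi b c (by linarith) hbc)]
  have hu1 : ∀ x, 0 < x → x ≤ 1 → u x = v x := by
    intro x hx hx1
    have e : ∫ t in x..1, g t = ∫ t in x..1, deriv v t := by
      rw [intervalIntegral.integral_of_le hx1, intervalIntegral.integral_of_le hx1]
      refine setIntegral_congr_fun measurableSet_Ioc fun t ht => ?_
      simp only [g, g1, g2, indicator_of_mem (show t ∈ Iic (1 : ℝ) from ht.2),
        indicator_of_notMem (show t ∉ Ioi (1 : ℝ) from not_lt.2 ht.2), add_zero]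
    simp only [hu_def]
    rw [intervalIntegral.integral_symm, e, (hv.2 x hx hx1).integral_deriv_eq_sub]
    ring
  have hgI : ∀ (n : ℕ), ∀ t ∈ Ioc ((n : ℝ) + 1) (n + 1 + 1), g t = d (n + 2) := by
    intro n t ht
    have h1 : 1 < t := lt_of_le_of_lt (by simp) ht.1
    have hceil : ⌈t⌉₊ = n + 2 := by
      rw [Nat.ceil_eq_iff (by omega)]
      constructor
      · simpa using ht.1
      · have := ht.2
        push_cast
        linarith
    simp only [g, g1, g2, D, indicator_of_mem (show t ∈ Ioi (1 : ℝ) from h1),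
      indicator_of_notMem (show t ∉ Iic (1 : ℝ) from not_le.2 h1), zero_add, hceil]
  have huk : ∀ n : ℕ, u ((n : ℝ) + 1) = v ((n : ℝ) + 1) := by
    intro n
    induction n with
    | zero => simpa using hu1 1 one_pos le_rfl
    | succ n ih =>
      push_cast
      have hle : (n : ℝ) + 1 ≤ n + 1 + 1 := by linarith
      rw [hadd _ _ (by simp) hle, ih, intervalIntegral.integral_of_le hle,
        setIntegral_congr_fun measurableSet_Ioc (hgI n)]
      have e : d (n + 2) = v ((n : ℝ) + 1 + 1) - v ((n : ℝ) + 1) := by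
        simp only [d]
        push_cast
        rw [show (n : ℝ) + 2 = n + 1 + 1 by ring, add_sub_cancel_right]
      simp [e]
  have hg2z : ∀ t, (N : ℝ) + 1 < t → g2 t = 0 := by
    intro t ht
    have h1 : N + 1 < ⌈t⌉₊ := Nat.lt_ceil.2 (by push_cast; exact ht)
    by_cases h : t ∈ Ioi (1 : ℝ)
    · rw [show g2 t = D t from indicator_of_mem h _]
      exact hd _ (by omega)
    · exact indicator_of_notMem h _
  have huN : ∀ x, (N : ℝ) + 1 ≤ x → u x = 0 := by
    intro x hx
    have hv0 := hN ⟨N + 1, by omega⟩ (by simp)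
    simp only [PNat.mk_coe, Nat.cast_add, Nat.cast_one] at hv0
    rw [hadd _ _ (by simp) hx, huk, hv0, zero_add, intervalIntegral.integral_of_le hx]
    refine setIntegral_eq_zero_of_forall_eq_zero fun t ht => ?_
    have h1 : 1 < t := lt_of_le_of_lt (by simp) ht.1
    simp only [g, g1, indicator_of_notMem (show t ∉ Iic (1 : ℝ) from not_le.2 h1), zero_add,
      hg2z t ht.1]
  -- On `(0, 1)` the measure `m` is twice the absolutely continuous part of `μ`, so square
  -- integrability carries over.
  have hbound : ∀ w : ℝ → ℝ, (∫⁻ x in Ioo (0 : ℝ) 1, ENNReal.ofReal (x ^ 2) * ‖w x‖ₑ ^ 2) < ⊤ →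
      ∀ w' : ℝ → ℝ, AEStronglyMeasurable w' m → EqOn w' w (Ioo 0 1) → (∀ x, 1 < x → w' x = 0) →
      MemLp w' 2 m := by
    intro w hw w' hm he h0
    rw [memLp_two_iff hm, lintegral_m, ← Ioc_union_Ioi_eq_Ioi zero_le_one]
    refine (lintegral_union_le _ _ _).trans_lt (ENNReal.add_lt_top.2 ⟨?_, ?_⟩)
    · rw [← restrict_Ioo_eq_restrict_Ioc]
      have : ∫⁻ x in Ioo (0 : ℝ) 1, ENNReal.ofReal (2 * x ^ 2) * ‖w' x‖ₑ ^ 2 =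
          ∫⁻ x in Ioo (0 : ℝ) 1, 2 * (ENNReal.ofReal (x ^ 2) * ‖w x‖ₑ ^ 2) := by
        refine setLIntegral_congr_fun measurableSet_Ioo fun x hx => ?_
        simp only [he hx]
        rw [ENNReal.ofReal_mul two_pos.le, mul_assoc]
        simp
      rw [this, lintegral_const_mul' _ _ (by simp)]
      exact ENNReal.mul_lt_top (by simp) hw
    · rw [setLIntegral_congr_fun (g := fun _ => 0) measurableSet_Ioi fun x hx => by
        simp [h0 x hx]]
      simp
  have hder' : deriv u =ᵐ[m] g := ae_m_iff.2 (hder.mono fun x hx h0 => (hx h0).deriv)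
  have hg1mem : MemLp g1 2 m := by
    refine hbound (deriv v) ?_ g1 ?_ (fun x hx => ?_) fun x hx => ?_
    · convert hE using 1
      refine setLIntegral_congr_fun measurableSet_Ioo fun x _ => ?_
      simp only [enorm_sq_eq_ofReal]
      rw [← ENNReal.ofReal_mul (by positivity), mul_comm]
    · exact (aestronglyMeasurable_deriv v m).indicator measurableSet_Iic
    · exact indicator_of_mem (show x ∈ Iic (1 : ℝ) from hx.2.le) _
    · exact indicator_of_notMem (show x ∉ Iic (1 : ℝ) from not_le.2 hx) _
  have hg2mem : MemLp g2 2 m := by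
    refine memLp_m_of_bounded_of_support (b := 0) (c := N + 2) hg2m.aestronglyMeasurable
      (fun x _ => hg2M x) fun x hx hxn => hg2z x ?_
    have : (N : ℝ) + 2 ≤ x := not_lt.1 fun h => hxn ⟨hx, h⟩
    linarith
  have hum : MemLp u 2 m := by
    have e : u = (Iio (1 : ℝ)).indicator u + (Ici (1 : ℝ)).indicator u := by
      rw [← compl_Iio, indicator_self_add_compl]
    rw [e]
    refine MemLp.add (hbound v ?_ _ (hac.aestronglyMeasurable.indicator measurableSet_Iio)
      (fun x hx => ?_) fun x hx => ?_) ?_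
    · have h1 := (memLp_two_iff (Lp.aestronglyMeasurable f)).1 (Lp.memLp f)
      rw [lintegral_congr_ae (g := fun x => ‖v x‖ₑ ^ 2) (hv.1.mono fun x hx => by
        simp only [hx]), lintegral_mu] at h1
      exact (ENNReal.add_lt_top.1 h1).1
    · rw [indicator_of_mem (show x ∈ Iio (1 : ℝ) from hx.2), hu1 x hx.1 hx.2.le]
    · exact indicator_of_notMem (show x ∉ Iio (1 : ℝ) from not_lt.2 hx.le) _
    · obtain ⟨K, hK⟩ := (hac 1 (N + 1) one_pos (by simp)).exists_bound
      rw [uIcc_of_le (by simp)] at hK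
      have hK0 : 0 ≤ K := (norm_nonneg _).trans (hK 1 (by simp))
      -- The left endpoint lies below `1` because the support criterion uses an open interval and
      -- the function may be nonzero at `1`.
      refine memLp_m_of_bounded_of_support (b := 1 / 2) (c := N + 1) (M := K)
        (hac.aestronglyMeasurable.indicator measurableSet_Ici) (fun x _ => ?_) fun x _ hxn => ?_
      · by_cases hx : x ∈ Ici (1 : ℝ)
        · rw [indicator_of_mem hx]
          rcases le_total x (N + 1) with h | h
          · exact hK x ⟨hx, h⟩
          · rw [huN x h, abs_zero]; exact hK0
        · rw [indicator_of_notMem hx, abs_zero]; exact hK0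
      · by_cases hx : x ∈ Ici (1 : ℝ)
        · rw [indicator_of_mem hx]
          refine huN x (not_lt.1 fun h => hxn ⟨?_, h⟩)
          have : (1 : ℝ) ≤ x := hx
          linarith
        · exact indicator_of_notMem hx _
  refine ⟨u, inDom_iff.2 ⟨hac, (memLp_congr_ae hder').2 (hg1mem.add hg2mem), hum⟩,
    (ae_mu_iff ha).2 ⟨?_, fun k => ?_⟩⟩
  · filter_upwards [((ae_mu_iff ha).1 hv.1).1] with x hx h0
    rw [hx h0, hu1 x h0.1 h0.2.le]
  · rw [((ae_mu_iff ha).1 hv.1).2 k]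
    have h := huk (k - 1)
    have : ((k - 1 : ℕ) : ℝ) + 1 = k := by
      rw [Nat.cast_sub (show 1 ≤ (k : ℕ) from k.pos)]; simp
    rw [this] at h
    exact h.symm

theorem mk_sub_mem {H Y : Type*} [NormedAddCommGroup H] [InnerProductSpace ℝ H]
    [NormedAddCommGroup Y] [InnerProductSpace ℝ Y] {G : Submodule ℝ (H × Y)} {f g : H} {y z : Y}
    (h : (f, y) ∈ G) (h' : (g, z) ∈ G) : (f - g, y - z) ∈ G := G.sub_mem h h'

theorem mem_topologicalClosure_of_sub_mem {H Y : Type*} [NormedAddCommGroup H]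
    [InnerProductSpace ℝ H] [NormedAddCommGroup Y] [InnerProductSpace ℝ Y]
    {G : Submodule ℝ (H × Y)} {f : H} {y : Y} {g : ℕ → H} {z : ℕ → Y}
    (hg : Tendsto g atTop (𝓝 0)) (hz : Tendsto z atTop (𝓝 0))
    (h : ∀ n, (f - g n, y - z n) ∈ G) : (f, y) ∈ G.topologicalClosure := by
  have h1 := (tendsto_const_nhds (x := f)).sub hg
  have h2 := (tendsto_const_nhds (x := y)).sub hz
  rw [sub_zero] at h1 h2
  exact mem_closure_of_tendsto (h1.prodMk_nhds h2) (Eventually.of_forall h)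

/-- Dominated convergence for the squared norms, with majorant `B²`. -/
theorem tendsto_toLp_zero {κ : Measure ℝ} {h : ℕ → ℝ → ℝ} (hm : ∀ n, MemLp (h n) 2 κ)
    {B : ℝ → ℝ} (hB : MemLp B 2 κ) (hle : ∀ n, ∀ᵐ x ∂κ, |h n x| ≤ |B x|)
    (hlim : ∀ᵐ x ∂κ, Tendsto (fun n => h n x) atTop (𝓝 0)) :
    Tendsto (fun n => (hm n).toLp) atTop (𝓝 0) := by
  have h1 : Tendsto (fun n => ∫⁻ x, ‖h n x‖ₑ ^ 2 ∂κ) atTop (𝓝 (∫⁻ _, 0 ∂κ)) := by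
    refine tendsto_lintegral_of_dominated_convergence' (fun x => ‖B x‖ₑ ^ 2)
      (fun n => (hm n).1.enorm.pow_const 2) (fun n => ?_) ((memLp_two_iff hB.1).1 hB).ne ?_
    · filter_upwards [hle n] with x hx
      rw [enorm_sq_eq_ofReal, enorm_sq_eq_ofReal]
      exact ENNReal.ofReal_le_ofReal (sq_le_sq.2 hx)
    · filter_upwards [hlim] with x hx
      have := (ENNReal.continuous_pow 2).tendsto _ |>.comp hx.enorm
      simpa [Function.comp_def] using this
  have h2 : ∀ n, ∫⁻ x, ‖h n x‖ₑ ^ 2 ∂κ = ‖(hm n).toLp‖ₑ ^ 2 := fun n => by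
    rw [enorm_sq_Lp]
    exact lintegral_congr_ae ((hm n).coeFn_toLp.mono fun x hx => by simp only [hx])
  rw [lintegral_zero] at h1
  have h3 := ((ENNReal.tendsto_toReal ENNReal.zero_ne_top).comp h1).sqrt
  rw [tendsto_zero_iff_norm_tendsto_zero]
  simpa [Function.comp_def, h2, Real.sqrt_sq] using h3

/-- Truncation at height `ε`. -/
noncomputable def clamp (ε x : ℝ) : ℝ := max (-ε) (min ε x)

theorem abs_clamp_le {ε : ℝ} (hε : 0 ≤ ε) (x : ℝ) : |clamp ε x| ≤ ε :=
  abs_le.2 ⟨le_max_left _ _, max_le (by linarith) (min_le_left _ _)⟩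

/-- The normal contraction property: truncation does not enlarge increments, so the truncated
gradients are dominated by the original one. -/
theorem abs_clamp_sub_le (ε x y : ℝ) : |clamp ε x - clamp ε y| ≤ |x - y| := by
  refine (abs_max_sub_max_le_max _ _ _ _).trans ?_
  refine max_le (by simp) ((abs_min_sub_min_le_max _ _ _ _).trans ?_)
  exact max_le (by simp) le_rfl

theorem clamp_eq_self {ε x : ℝ} (h : |x| ≤ ε) : clamp ε x = x := by
  rw [clamp, min_eq_right (abs_le.1 h).2, max_eq_right (abs_le.1 h).1]

theorem abs_clamp_le_abs {ε : ℝ} (hε : 0 ≤ ε) (x : ℝ) : |clamp ε x| ≤ |x| := by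
  have := abs_clamp_sub_le ε x 0
  rwa [clamp_eq_self (x := 0) (by simpa using hε), sub_zero, sub_zero] at this

/-- Functions in the maximal domain which tend to zero along `ℕ` are limits of functions in
`ran J`. -/
theorem mem_closure_ranJGraph {a : ℕ+ → ℝ} (ha : ∀ k, 0 < a k) {f : L2 a} {y : L2 jc}
    {ψ : ℝ → ℝ} (hψ : IsACVersion a f ψ) (hy : y =ᵐ[mu jc] grad ψ)
    (hlim : Tendsto (fun n : ℕ => ψ ((n : ℝ) + 1)) atTop (𝓝 0)) :
    (f, y) ∈ (ranJGraph a).topologicalClosure := by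
  set ε : ℕ → ℝ := fun n => 1 / ((n : ℝ) + 1)
  have hε : ∀ n, 0 < ε n := fun n => Nat.one_div_pos_of_nat
  have hε0 : Tendsto ε atTop (𝓝 0) := tendsto_one_div_add_atTop_nhds_zero_nat
  -- Truncation of `ψ` on `[1, ∞)`, frozen at its value at `1` to the left, so it has no gradient on
  -- `(0, 1)`. It tends to zero with `ε n`, and `ψ - γ n` vanishes at each positive integer where
  -- `|ψ| ≤ ε n`.
  set γ : ℕ → ℝ → ℝ := fun n x => clamp (ε n) (ψ (max x 1))
  have hγ1 : ∀ n x, x ≤ 1 → γ n x = clamp (ε n) (ψ 1) := fun n x hx => by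
    simp only [γ, max_eq_right hx]
  have hγk : ∀ n x, 1 ≤ x → γ n x = clamp (ε n) (ψ x) := fun n x hx => by
    simp only [γ, max_eq_left hx]
  have hgradψ : MemLp (grad ψ) 2 (mu jc) := (memLp_congr_ae hy).1 (Lp.memLp y)
  have hBm : MemLp (fun x => ψ (max x 1)) 2 (mu a) := by
    have hmeas : AEStronglyMeasurable (fun x => ψ (max x 1)) (mu a) := by
      refine aestronglyMeasurable_mu ?_
      refine (aestronglyMeasurable_const (b := ψ 1)).congr ?_
      filter_upwards [ae_restrict_mem measurableSet_Ioo] with x hx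
      rw [max_eq_right hx.2.le]
    rw [memLp_two_iff hmeas, lintegral_mu]
    refine ENNReal.add_lt_top.2 ⟨?_, ?_⟩
    · calc ∫⁻ x in Ioo (0 : ℝ) 1, ENNReal.ofReal (x ^ 2) * ‖ψ (max x 1)‖ₑ ^ 2
          ≤ ∫⁻ _ in Ioo (0 : ℝ) 1, ‖ψ 1‖ₑ ^ 2 := by
            refine setLIntegral_mono' measurableSet_Ioo fun x hx => ?_
            rw [max_eq_right hx.2.le]
            refine mul_le_of_le_one_left' (ENNReal.ofReal_le_one.2 ?_)
            exact pow_le_one₀ hx.1.le hx.2.le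
        _ < ⊤ := by
            rw [setLIntegral_const]
            exact ENNReal.mul_lt_top (by simp) (by simp)
    · have h1 := (memLp_two_iff (Lp.aestronglyMeasurable f)).1 (Lp.memLp f)
      rw [lintegral_congr_ae (g := fun x => ‖ψ x‖ₑ ^ 2) (hψ.1.mono fun x hx => by
        simp only [hx]), lintegral_mu] at h1
      convert (ENNReal.add_lt_top.1 h1).2 using 5 with k
      rw [max_eq_left (one_le_pnat k)]
  have hγm : ∀ n, MemLp (γ n) 2 (mu a) := by
    intro n
    refine hBm.mono (aestronglyMeasurable_mu ?_) (Eventually.of_forall fun x =>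
      abs_clamp_le_abs (hε n).le _)
    refine (aestronglyMeasurable_const (b := clamp (ε n) (ψ 1))).congr ?_
    filter_upwards [ae_restrict_mem measurableSet_Ioo] with x hx using (hγ1 n x hx.2.le).symm
  have hgrad1 : ∀ n x, x < 1 → grad (γ n) x = 0 := by
    intro n x hx
    rw [grad_of_lt hx]
    have : γ n =ᶠ[𝓝 x] fun _ => clamp (ε n) (ψ 1) := by
      filter_upwards [Iio_mem_nhds hx] with t ht using hγ1 n t (le_of_lt ht)
    rw [this.deriv_eq, deriv_const]
  have hgradk : ∀ n (k : ℕ+), grad (γ n) k = clamp (ε n) (ψ ((k : ℝ) + 1)) - clamp (ε n) (ψ k) := by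
    intro n k
    have := one_le_pnat k
    rw [grad_pnat, hγk n _ this, hγk n _ (by linarith)]
  have hle : ∀ n, ∀ᵐ x ∂(mu jc), |grad (γ n) x| ≤ |grad ψ x| := by
    refine fun n => (ae_mu_iff jc_pos).2 ⟨Eventually.of_forall fun x hx => ?_, fun k => ?_⟩
    · rw [hgrad1 n x hx.2, abs_zero]; exact abs_nonneg _
    · rw [hgradk, grad_pnat]; exact abs_clamp_sub_le _ _ _
  have hγg : ∀ n, MemLp (grad (γ n)) 2 (mu jc) := fun n =>
    hgradψ.mono (aestronglyMeasurable_grad _ _) (hle n)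
  have hl1 : Tendsto (fun n => (hγm n).toLp) atTop (𝓝 0) := by
    refine tendsto_toLp_zero hγm hBm (fun n => Eventually.of_forall fun x =>
      abs_clamp_le_abs (hε n).le _) (Eventually.of_forall fun x => ?_)
    exact squeeze_zero_norm (fun n => abs_clamp_le (hε n).le _) hε0
  have hl2 : Tendsto (fun n => (hγg n).toLp) atTop (𝓝 0) := by
    refine tendsto_toLp_zero hγg hgradψ hle ((ae_mu_iff jc_pos).2
      ⟨Eventually.of_forall fun x hx => ?_, fun k => ?_⟩)
    · simp only [hgrad1 _ x hx.2]; exact tendsto_const_nhds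
    · have h2 : Tendsto (fun n => ε n + ε n) atTop (𝓝 0) := by simpa using hε0.add hε0
      refine squeeze_zero_norm (fun n => ?_) h2
      rw [hgradk, Real.norm_eq_abs]
      exact (abs_sub _ _).trans (add_le_add (abs_clamp_le (hε n).le _) (abs_clamp_le (hε n).le _))
  have hver : ∀ n, IsACVersion a (hγm n).toLp (γ n) := fun n =>
    ⟨(hγm n).coeFn_toLp, fun b _ hb1 => AbsolutelyContinuousOnInterval.congr
      (LipschitzWith.const (clamp (ε n) (ψ 1))).lipschitzOnWith.absolutelyContinuousOnInterval
      fun x hx => (hγ1 n x (by rw [uIcc_of_le hb1] at hx; exact hx.2)).symm⟩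
  have hmem : ∀ n, (f - (hγm n).toLp, y - (hγg n).toLp) ∈ ranJGraph a := by
    intro n
    have hG : (f - (hγm n).toLp, y - (hγg n).toLp) ∈ gradGraph a :=
      mk_sub_mem (mem_gradGraph.2 ⟨ψ, hψ, hy⟩) (mem_gradGraph_toLp (hver n) (hγg n))
    have hv : IsACVersion a (f - (hγm n).toLp) (ψ + (-1 : ℝ) • γ n) := by
      have := hψ.add ((hver n).const_smul (-1))
      rwa [neg_smul, one_smul, ← sub_eq_add_neg] at this
    obtain ⟨N, hN⟩ := eventually_atTop.1 (hlim.eventually (Metric.ball_mem_nhds 0 (hε n)))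
    refine ⟨hG, mem_ranJ_of_eventually_zero ha hv ?_ (N := N + 1) fun k hk => ?_⟩
    · obtain ⟨φ, hφ, hlt⟩ := mem_maxDom_iff.2 ⟨_, hG⟩
      rw [← contForm_eq hv, contForm_eq hφ]
      exact (ENNReal.add_lt_top.1 hlt).1
    · have h := hN (k - 1) (by omega)
      have e : ((k - 1 : ℕ) : ℝ) + 1 = k := by
        rw [Nat.cast_sub (show 1 ≤ (k : ℕ) from k.pos)]; simp
      rw [e] at h
      replace h : |ψ k| < ε n := by simpa [Real.dist_eq] using h
      simp [hγk n k (one_le_pnat k), clamp_eq_self h.le]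
  exact mem_topologicalClosure_of_sub_mem hl1 hl2 hmem

/-! ### Infinite discrete mass forces decay along the integers -/

theorem not_summable_of_muDisc_eq_top {a : ℕ+ → ℝ} (ha : ∀ k, 0 < a k)
    (h : muDisc a (range fun k : ℕ+ => (k : ℝ)) = ⊤) : ¬ Summable a := by
  intro hs
  have h1 : muDisc a univ = ⊤ := top_le_iff.1 (h ▸ measure_mono (subset_univ _))
  rw [muDisc, Measure.sum_apply _ MeasurableSet.univ] at h1
  simp only [Measure.smul_apply, measure_univ, smul_eq_mul, mul_one] at h1
  rw [← ENNReal.ofReal_tsum_of_nonneg (fun k => (ha k).le) hs] at h1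
  exact ENNReal.ofReal_ne_top h1

theorem summable_of_lintegral_lt_top {a : ℕ+ → ℝ} (ha : ∀ k, 0 < a k) {ψ : ℝ → ℝ}
    (h : ∫⁻ x, ‖ψ x‖ₑ ^ 2 ∂(mu a) < ⊤) : Summable fun k : ℕ+ => a k * ψ k ^ 2 := by
  rw [lintegral_mu] at h
  have h1 := ENNReal.summable_toReal (ENNReal.add_lt_top.1 h).2.ne
  refine h1.congr fun k => ?_
  have := (ha k).le
  rw [enorm_sq_eq_ofReal, ← ENNReal.ofReal_mul this, ENNReal.toReal_ofReal (by positivity)]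

/-- For an increment of size `t` and weight `j`, `t ≤ j t² + 1 / j`; both terms are summable over
`k`, so `ψ(k)` is Cauchy. A limit `L ≠ 0` would give `a k ≤ (2 / L²) a k ψ(k)²` eventually, making
`a` summable. -/
theorem tendsto_zero_of_not_summable {a : ℕ+ → ℝ} (ha : ∀ k, 0 < a k) (hs : ¬ Summable a)
    {ψ : ℝ → ℝ} (h1 : Summable fun k : ℕ+ => a k * ψ k ^ 2)
    (h2 : Summable fun k : ℕ+ => jc k * grad ψ k ^ 2) :
    Tendsto (fun n : ℕ => ψ ((n : ℝ) + 1)) atTop (𝓝 0) := by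
  have h1 := (Equiv.pnatEquivNat.symm.summable_iff).2 h1
  have h2 := (Equiv.pnatEquivNat.symm.summable_iff).2 h2
  have hs := mt (Equiv.pnatEquivNat.symm.summable_iff).1 hs
  simp only [Function.comp_def, Equiv.pnatEquivNat_symm_apply] at h1 h2 hs
  have h3 : Summable fun n : ℕ => (jc n.succPNat)⁻¹ := by
    have := (summable_nat_add_iff 1).2 (Real.summable_one_div_nat_pow.2 one_lt_two)
    refine Summable.of_nonneg_of_le (fun n => (inv_pos.2 (jc_pos _)).le) (fun n => ?_) this
    rw [one_div]
    refine inv_anti₀ (by positivity) ?_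
    simp only [jc, Nat.succPNat_coe, Nat.succ_eq_add_one]
    push_cast
    nlinarith [n.cast_nonneg (α := ℝ)]
  have hc : CauchySeq fun n : ℕ => ψ ((n : ℝ) + 1) := by
    refine cauchySeq_of_summable_dist (Summable.of_nonneg_of_le (fun _ => dist_nonneg)
      (fun n => ?_) (h2.add h3))
    have hj := jc_pos n.succPNat
    have e : dist (ψ ((n : ℝ) + 1)) (ψ (((n.succ : ℕ) : ℝ) + 1)) = |grad ψ (n.succPNat : ℕ)| := by
      rw [grad_pnat, dist_comm, Real.dist_eq]
      simp
    rw [e, ← sq_abs (grad ψ _)]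
    set t := |grad ψ (n.succPNat : ℕ)|
    set j := jc n.succPNat
    have h4 : 0 ≤ (j * t - 1) ^ 2 := sq_nonneg _
    have ht : 0 ≤ t := abs_nonneg _
    have h5 : t * j ≤ (j * t ^ 2 + j⁻¹) * j := by
      rw [add_mul, inv_mul_cancel₀ hj.ne']
      nlinarith [mul_nonneg hj.le ht]
    exact le_of_mul_le_mul_right h5 hj
  obtain ⟨L, hL⟩ := cauchySeq_tendsto_of_complete hc
  rcases eq_or_ne L 0 with rfl | h0
  · exact hL
  refine absurd ?_ hs
  have hL2 : 0 < L ^ 2 := by positivity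
  have hev := (hL.pow 2).eventually_const_lt (half_lt_self hL2)
  refine Summable.of_norm_bounded_eventually_nat (h1.mul_left (2 / L ^ 2)) ?_
  filter_upwards [hev] with n hn
  have hp := ha n.succPNat
  rw [Real.norm_eq_abs, abs_of_pos hp]
  simp only [Nat.succPNat_coe, Nat.succ_eq_add_one]
  push_cast
  have : 1 ≤ 2 / L ^ 2 * ψ ((n : ℝ) + 1) ^ 2 := by
    rw [div_mul_eq_mul_div, le_div_iff₀ hL2]
    linarith
  calc a n.succPNat = a n.succPNat * 1 := (mul_one _).symm
    _ ≤ a n.succPNat * (2 / L ^ 2 * ψ ((n : ℝ) + 1) ^ 2) := by gcongr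
    _ = _ := by ring

theorem closure_ranJGraph_eq {a : ℕ+ → ℝ} (ha : ∀ k, 0 < a k)
    (h : muDisc a (range fun k : ℕ+ => (k : ℝ)) = ⊤) :
    (ranJGraph a).topologicalClosure = gradGraph a := by
  refine le_antisymm (closure_ranJGraph_le ha) ?_
  rintro ⟨f, y⟩ ⟨ψ, hψ, hy⟩
  have h1 := (memLp_congr_ae hψ.1).1 (Lp.memLp f)
  have h2 := (memLp_congr_ae hy).1 (Lp.memLp y)
  exact mem_closure_ranJGraph ha hψ hy (tendsto_zero_of_not_summable ha
    (not_summable_of_muDisc_eq_top ha h)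
    (summable_of_lintegral_lt_top ha ((memLp_two_iff h1.1).1 h1))
    (summable_of_lintegral_lt_top jc_pos ((memLp_two_iff h2.1).1 h2)))

/-! ### The strongly local part and the jump part -/

theorem IsACVersion.continuousOn {a : ℕ+ → ℝ} {f : L2 a} {ψ : ℝ → ℝ} (h : IsACVersion a f ψ) :
    ContinuousOn ψ (Ioo 0 1) := by
  intro x hx
  have h4 := (h.2 (x / 2) (by linarith [hx.1]) (by linarith [hx.1, hx.2])).continuousOn
  rw [uIcc_of_le (by linarith [hx.1, hx.2])] at h4
  exact (h4.continuousAt (Icc_mem_nhds (by linarith [hx.1]) hx.2)).continuousWithinAt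

/-- Continuity of the version on `(0, 1)` upgrades a.e. equality to equality on the open set. -/
theorem IsACVersion.eqOn_const {a : ℕ+ → ℝ} (ha : ∀ k, 0 < a k) {f : L2 a} {ψ : ℝ → ℝ}
    (h : IsACVersion a f ψ) {V : Set ℝ} (hV : IsOpen V) {c : ℝ}
    (hc : ∀ᵐ x ∂(mu a), x ∈ V → f x = c) : EqOn ψ (fun _ => c) (V ∩ Ioo 0 1) := by
  refine Measure.eqOn_open_of_ae_eq (μ := volume) ?_ (hV.inter isOpen_Ioo)
    (h.continuousOn.mono inter_subset_right) continuousOn_const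
  rw [EventuallyEq, ae_restrict_iff' (hV.inter isOpen_Ioo).measurableSet]
  filter_upwards [((ae_mu_iff ha).1 hc).1, ((ae_mu_iff ha).1 h.1).1] with x h1 h2 hx
  rw [← h2 hx.2, h1 hx.2 hx.1]

/-- The integrands agree at every point of `(0, 1)`: inside `V` the version of `v` is locally
constant, and outside `V`, hence off the support of `u`, the version of `u` vanishes in a
neighbourhood. -/
theorem stronglyLocalOn_contForm {a : ℕ+ → ℝ} (ha : ∀ k, 0 < a k) :
    StronglyLocalOn (mu a) (maxDom a) (contForm a) := by
  rintro u ⟨ψ, hψ, -⟩ v ⟨φ, hφ, -⟩ V c hV hsupp hc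
  rw [contForm_eq hψ, contForm_eq hφ, contForm_eq (hψ.add hφ), contEnergy, contEnergy, contEnergy,
    ← lintegral_add_left (by fun_prop)]
  set κ := (mu a).withDensity fun x => ‖u x‖ₑ
  have hu0 : ∀ᵐ x ∂(mu a), x ∈ κ.supportᶜ → u x = 0 := by
    have h1 : ∀ᵐ x ∂κ, x ∉ κ.supportᶜ := measure_eq_zero_iff_ae_notMem.1
      Measure.measure_compl_support
    rw [ae_withDensity_iff (Lp.stronglyMeasurable u).measurable.enorm] at h1
    filter_upwards [h1] with x hx hxs
    by_contra h
    exact hx (by simpa using h) hxs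
  have hφV := hφ.eqOn_const ha hV hc
  have hψW := hψ.eqOn_const ha Measure.isOpen_compl_support hu0
  refine setLIntegral_congr_fun measurableSet_Ioo fun x hx => ?_
  by_cases hxV : x ∈ V
  · have hn := (hV.inter isOpen_Ioo).mem_nhds ⟨hxV, hx⟩
    have e1 : deriv φ x = 0 := by
      rw [(hφV.eventuallyEq_of_mem hn).deriv_eq, deriv_const]
    have e2 : ψ + φ =ᶠ[𝓝 x] fun t => ψ t + c := by
      filter_upwards [hn] with t ht
      rw [Pi.add_apply, hφV ht]
    simp [e1, e2.deriv_eq]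
  · have hn := (Measure.isOpen_compl_support.inter isOpen_Ioo).mem_nhds
      ⟨fun h => hxV (hsupp h), hx⟩
    have e1 : deriv ψ x = 0 := by
      rw [(hψW.eventuallyEq_of_mem hn).deriv_eq, deriv_const]
    have e2 : ψ + φ =ᶠ[𝓝 x] φ := by
      filter_upwards [hn] with t ht
      rw [Pi.add_apply, hψW ht, zero_add]
    simp [e1, e2.deriv_eq]

/-- The jump measure, charging `(k, k + 1)` and `(k + 1, k)` with `k (k + 1) / 2`. -/
noncomputable def jumpMeasure : Measure (ℝ × ℝ) :=
  Measure.sum fun k : ℕ+ => ENNReal.ofReal (jc k / 2) •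
    (Measure.dirac ((k : ℝ), (k : ℝ) + 1) + Measure.dirac ((k : ℝ) + 1, (k : ℝ)))

theorem jumpMeasure_apply {s : Set (ℝ × ℝ)} (hs : MeasurableSet s) :
    jumpMeasure s = ∑' k : ℕ+, ENNReal.ofReal (jc k / 2) *
      (s.indicator 1 ((k : ℝ), (k : ℝ) + 1) + s.indicator 1 ((k : ℝ) + 1, (k : ℝ))) := by
  simp [jumpMeasure, Measure.sum_apply _ hs, Measure.dirac_apply' _ hs, mul_add]

theorem lintegral_jumpMeasure (g : ℝ × ℝ → ℝ≥0∞) :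
    ∫⁻ p, g p ∂jumpMeasure = ∑' k : ℕ+, ENNReal.ofReal (jc k / 2) *
      (g ((k : ℝ), (k : ℝ) + 1) + g ((k : ℝ) + 1, (k : ℝ))) := by
  simp [jumpMeasure, lintegral_sum_measure, lintegral_add_measure, mul_add]

/-- A half plane bounded on the right in the first coordinate meets only finitely many atoms. -/
theorem isLocallyFiniteMeasure_jumpMeasure : IsLocallyFiniteMeasure jumpMeasure := by
  refine ⟨fun p => ⟨{q | q.1 < p.1 + 1}, ?_, ?_⟩⟩
  · exact (isOpen_lt continuous_fst continuous_const).mem_nhds (lt_add_one p.1)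
  obtain ⟨N, hN⟩ := exists_nat_gt (p.1 + 1)
  rw [jumpMeasure_apply (measurableSet_lt measurable_fst measurable_const),
    tsum_eq_sum (s := Finset.Icc 1 N.succPNat) fun k hk => ?_]
  · refine ENNReal.sum_lt_top.2 fun k _ => ENNReal.mul_lt_top ENNReal.ofReal_lt_top ?_
    refine ENNReal.add_lt_top.2 ⟨?_, ?_⟩ <;>
    · refine (indicator_le_self' (fun _ _ => zero_le) _).trans_lt ?_
      simp
  · have h1 : N.succPNat < k := by
      simpa [Finset.mem_Icc] using hk
    have h2 : (N : ℝ) + 1 < k := by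
      have : (N.succPNat : ℕ) < k := h1
      simp only [Nat.succPNat_coe, Nat.succ_eq_add_one] at this
      exact_mod_cast this
    rw [indicator_of_notMem, indicator_of_notMem]
    · simp
    · simp only [mem_ofPred_eq, not_lt]; linarith
    · simp only [mem_ofPred_eq, not_lt]; linarith

/-- Each jump is counted in both directions, which the weight `jc k / 2` compensates. The marginal
sits on the positive integers, each charged by `μ` because `a k > 0`. -/
theorem pureJumpOn_jumpForm {a : ℕ+ → ℝ} (ha : ∀ k, 0 < a k) :
    PureJumpOn (mu a) (maxDom a) (jumpForm a) := by
  refine ⟨jumpMeasure, isLocallyFiniteMeasure_jumpMeasure, ?_, ?_, ?_, ?_⟩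
  · refine Measure.ext fun s hs => ?_
    rw [Measure.map_apply measurable_swap hs, jumpMeasure_apply (measurable_swap hs),
      jumpMeasure_apply hs]
    refine tsum_congr fun k => ?_
    rw [add_comm]
    rfl
  · rw [jumpMeasure_apply (measurableSet_eq_fun measurable_fst measurable_snd)]
    simp
  · refine Measure.AbsolutelyContinuous.mk fun s hs h0 => ?_
    have h1 := ((ae_mu_iff ha).1 (measure_eq_zero_iff_ae_notMem.1 h0)).2
    rw [Measure.map_apply measurable_fst hs, jumpMeasure_apply (measurable_fst hs)]
    refine ENNReal.tsum_eq_zero.2 fun k => ?_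
    have h2 := h1 (k + 1)
    push_cast at h2
    rw [indicator_of_notMem (show ((k : ℝ), (k : ℝ) + 1) ∉ Prod.fst ⁻¹' s from h1 k),
      indicator_of_notMem (show ((k : ℝ) + 1, (k : ℝ)) ∉ Prod.fst ⁻¹' s from h2)]
    simp
  · rintro f ⟨ψ, hψ, -⟩
    rw [jumpForm_eq ha hψ, lintegral_jumpMeasure, jumpEnergy]
    refine tsum_congr fun k => ?_
    have h1 := ((ae_mu_iff ha).1 hψ.1).2
    have h2 := h1 (k + 1)
    push_cast at h2
    have hj := jc_pos k
    simp only [h1 k, h2]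
    rw [← ENNReal.ofReal_add (sq_nonneg _) (sq_nonneg _), ← ENNReal.ofReal_mul (by positivity)]
    congr 1
    rw [jc]
    ring

end BesselTrace

/-! ### The main theorem -/

theorem mainTheorem6 (a : ℕ+ → ℝ) (ha : ∀ k, 0 < a k) :
    ∃ t : BesselTrace.L2 a → ℝ≥0∞,
      -- the trace form exists and is unique
      (∀ s, BesselTrace.IsTraceForm a s ↔ s = t) ∧
      -- it is the closure of `𝓠` restricted to `ran J`, which lies in the domain of `𝓠`
      BesselTrace.ranJ a ⊆ BesselTrace.maxDom a ∧
      BesselTrace.IsFormClosure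
        (BesselTrace.restrictForm (BesselTrace.Q a) (BesselTrace.ranJ a)) t ∧
      -- if `μ_disc(ℕ) = ∞`, it equals `𝓠` on the maximal domain
      (BesselTrace.muDisc a (Set.range fun k : ℕ+ => (k : ℝ)) = ⊤ → t = BesselTrace.Q a) ∧
      -- `𝓠` is the sum of a strongly local part and a jump part
      (∀ f ∈ BesselTrace.maxDom a,
        BesselTrace.Q a f = BesselTrace.contForm a f + BesselTrace.jumpForm a f) ∧
      (∀ f, BesselTrace.Q a f < ⊤ ↔ f ∈ BesselTrace.maxDom a) ∧
      BesselTrace.StronglyLocalOn (BesselTrace.mu a) (BesselTrace.maxDom a)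
        (BesselTrace.contForm a) ∧
      BesselTrace.PureJumpOn (BesselTrace.mu a) (BesselTrace.maxDom a)
        (BesselTrace.jumpForm a) := by
  open BesselTrace in
  refine ⟨graphForm (ranJGraph a).topologicalClosure, fun s => ⟨fun hs => ?_, ?_⟩,
    ranJ_subset_maxDom a, ?_, fun h => ?_, fun f hf => ?_, fun f => ?_,
    stronglyLocalOn_contForm ha, pureJumpOn_jumpForm ha⟩
  · exact IsMoscoLimitAtZero.unique hs (isTraceForm_closure ha)
  · rintro rfl
    exact isTraceForm_closure ha
  · rw [restrictForm_Q_ranJ ha]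
    exact isFormClosure_graphForm (singleValued_closure_ranJGraph ha)
  · rw [closure_ranJGraph_eq ha h, Q_eq_graphForm ha]
  · exact iInf_pos hf
  · rw [Q_eq_graphForm ha, graphForm_lt_top_iff, mem_maxDom_iff]
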